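/- Let $N$ be a number of modes, $\mathcal H=L^2(\mathbb R^N)$, and let $\mathbb R^{2N}$ be the phase space with coordinates ${\bf x}=(q_1,p_1,\ldots,q_N,p_N)^T$ and symplectic matrix ${\bf\Omega}=\bigoplus_{j=1}^N\begin{pmatrix}0&1\\-1&0\end{pmatrix}$. Let $W({\bf x})=e^{-i{\bf x}^T{\bf\Omega}{\bf R}}$, ${\bf R}=(Q_1,P_1,\ldots,Q_N,P_N)^T$, be the Weyl operators, i.e. $(W({\bf x})\psi)(t)=e^{i(p\cdot t-\frac12 q\cdot p)}\psi(t-q)$. An observable $\mathsf E$ with values in $\mathbb R^M$ is a normalized positive operator valued measure on the Borel sets of $\mathbb R^M$ acting in $\mathcal H$ ($\sigma$-additive in the weak operator topology), with characteristic function $\widehat{\mathsf E}({\bf p})=\int e^{i{\bf p}^T{\bf x}}\,\mathsf E(d{\bf x})$. It is Gaussian if $\widehat{\mathsf E}({\bf p})=e^{-\frac14{\bf p}^T{\bf B}_0{\bf p}-i{\bf v}_0^T{\bf p}}\,W({\bf A}_0{\bf p})$ for all ${\bf p}$, for some real matrices ${\bf A}_0$ ($2N\times M$), ${\bf B}_0$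 ($M\times M$) with ${\bf B}_0-i{\bf A}_0^T{\bf\Omega}{\bf A}_0\ge 0$, and some ${\bf v}_0\in\mathbb R^M$. A Gaussian phase space observable is a Gaussian observable with outcome space $\mathbb R^{2N}$ (i.e. $M=2N$). $\mathsf E$ is informationally complete if any two states (positive trace-one operators) $\rho,\sigma$ with $\mathrm{tr}[\rho\,\mathsf E(X)]=\mathrm{tr}[\sigma\,\mathsf E(X)]$ for all Borel sets $X$ are equal. For ${\bf a}\in\mathbb R^{2N}$ the generalized quadrature $\mathsf Q_{\bf a}$ is the sharp (projection valued) observable with outcome space $\mathbb R$ and characteristic function $p\mapsto W(p{\bf a})$, i.e. the spectral measure of $-{\bf a}^T{\bf\Omega}{\bf R}$. For a linear map ${\bf P}:\mathbb R^{2N}\to\mathbb R$ the marginal $\mathsf E_{\bf P}$ is $\mathsf E_{\bf P}(X)=\mathsf E({\bf P}^{-1}(X))$. A real-valued observable $\mathsf F$ is a Gaussian smearing of $\mathsf Q$ if $\mathsf F(X)=\int\mu(X-x)\,\mathsf Q(dx)$ for all Borel sets $X$, for some Gaussian probability measure $\mu$ on $\mathbb R$ (point masses allowed). Proposition. Let $\mathsf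 E$ be a Gaussian phase space observable. Then the following are equivalent: (i) $\mathsf E$ is informationally complete; (ii) there is a bijection ${\bf P}\mapsto\Phi({\bf P})$ from the set of all linear maps ${\bf P}:\mathbb R^{2N}\to\mathbb R$ onto the set $\{\mathsf Q_{\bf a}\mid{\bf a}\in\mathbb R^{2N}\}$ of generalized quadratures such that, for every ${\bf P}$, the marginal $\mathsf E_{\bf P}$ is a Gaussian smearing of $\Phi({\bf P})$. -/

import Mathlib

open MeasureTheory
open scoped InnerProductSpace ENNReal ComplexOrder

noncomputable section

namespace GaussianObs

/-! ### States and observables on a Hilbert space -/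

section Hilbert

variable {H : Type*} [NormedAddCommGroup H] [InnerProductSpace ℂ H] [CompleteSpace H]

variable (H) in
/-- The index set of a fixed orthonormal basis of `H`. -/
def basisIndex : Set H := (exists_hilbertBasis ℂ H).choose

variable (H) in
/-- A fixed orthonormal basis of `H`. -/
def stdBasis : HilbertBasis (basisIndex H) ℂ H :=
  (exists_hilbertBasis ℂ H).choose_spec.choose

/-- The trace `∑ᵢ ⟨eᵢ, T eᵢ⟩` (used only for trace class operators, for which the series converges
absolutely and does not depend on the basis). -/
def trace (T : H →L[ℂ] H) : ℂ := ∑' i, ⟪stdBasis H i, T (stdBasis H i)⟫_ℂ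

/-- States: positive operators of trace one. -/
structure IsState (ρ : H →L[ℂ] H) : Prop where
  isPositive : ρ.IsPositive
  hasSum_one : HasSum (fun i => ⟪stdBasis H i, ρ (stdBasis H i)⟫_ℂ) 1

/-- An observable with values in the measurable space `X`: a normalized positive operator valued
measure, `σ`-additive in the weak operator topology. -/
structure Observable (X : Type*) [MeasurableSpace X] (H : Type*) [NormedAddCommGroup H]
    [InnerProductSpace ℂ H] [CompleteSpace H] where
  toVectorMeasure : VectorMeasure X (H →WOT[ℂ] H)
  isPositive (s : Set X) : (toVectorMeasure s).toCLM.IsPositive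
  normalized : (toVectorMeasure Set.univ).toCLM = ContinuousLinearMap.id ℂ H

namespace Observable

variable {X Y : Type*} [MeasurableSpace X] [MeasurableSpace Y]

/-- The bounded operator `E(s)`. -/
def effect (E : Observable X H) (s : Set X) : H →L[ℂ] H := (E.toVectorMeasure s).toCLM

lemma effect_isPositive (E : Observable X H) (s : Set X) : (E.effect s).IsPositive :=
  E.isPositive s

lemma effect_empty (E : Observable X H) : E.effect ∅ = 0 := by
  have h := VectorMeasure.empty E.toVectorMeasure
  simp only [effect, h]
  rfl

lemma hasSum_inner_effect (E : Observable X H) {f : ℕ → Set X}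
    (hf : ∀ i, MeasurableSet (f i)) (hd : Pairwise (Function.onFun Disjoint f)) (φ ψ : H) :
    HasSum (fun i => ⟪φ, E.effect (f i) ψ⟫_ℂ) ⟪φ, E.effect (⋃ i, f i) ψ⟫_ℂ := by
  have h := E.toVectorMeasure.m_iUnion hf hd
  unfold HasSum at h ⊢
  have h2 := ContinuousLinearMapWOT.tendsto_iff_forall_inner_apply_tendsto.mp h ψ φ
  refine h2.congr fun s => ?_
  induction s using Finset.cons_induction with
  | empty => simp
  | cons a s ha ih =>
    rw [Finset.sum_cons, Finset.sum_cons, ContinuousLinearMapWOT.add_apply, inner_add_right, ih]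
    rfl

/-- The measure `s ↦ ⟨φ, E(s) φ⟩`. -/
def diagMeasure (E : Observable X H) (φ : H) : Measure X :=
  Measure.ofMeasurable (fun s _ => ENNReal.ofReal (⟪φ, E.effect s φ⟫_ℂ).re)
    (by simp [E.effect_empty])
    (by
      intro f hf hd
      have hs : HasSum (fun i => (⟪φ, E.effect (f i) φ⟫_ℂ).re)
          (⟪φ, E.effect (⋃ i, f i) φ⟫_ℂ).re :=
        Complex.hasSum_re (E.hasSum_inner_effect hf hd φ φ)
      rw [← hs.tsum_eq]
      exact ENNReal.ofReal_tsum_of_nonneg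
        (fun i => (E.effect_isPositive (f i)).re_inner_nonneg_right φ) hs.summable)

/-- `T = ∫ f dE` for a bounded measurable function `f`, in the weak sense:
`⟨φ, T φ⟩ = ∫ f(x) ⟨φ, E(dx) φ⟩` for all `φ`; by polarization `T` is unique. -/
def HasIntegral (E : Observable X H) (f : X → ℂ) (T : H →L[ℂ] H) : Prop :=
  ∀ φ : H, ⟪φ, T φ⟫_ℂ = ∫ x, f x ∂(E.diagMeasure φ)

/-- The outcome distribution `s ↦ tr[ρ E(s)]` in the state `ρ`. -/
def prob (E : Observable X H) (ρ : H →L[ℂ] H) (s : Set X) : ℂ := trace (ρ ∘L E.effect s)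

/-- `E` is informationally complete: its outcome statistics determine the state. -/
def InformationallyComplete (E : Observable X H) : Prop :=
  ∀ ρ σ : H →L[ℂ] H, IsState ρ → IsState σ →
    (∀ s, MeasurableSet s → E.prob ρ s = E.prob σ s) → ρ = σ

/-- `E` is sharp (projection valued): `E(s) E(t) = E(s ∩ t)`. -/
def IsSharp (E : Observable X H) : Prop :=
  ∀ s t, MeasurableSet s → MeasurableSet t → E.effect s ∘L E.effect t = E.effect (s ∩ t)

/-- The observable `s ↦ E(f⁻¹(s))`. -/
def map (E : Observable X H) (f : X → Y) (hf : Measurable f) : Observable Y H where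
  toVectorMeasure := E.toVectorMeasure.map f
  isPositive s := by
    by_cases hs : MeasurableSet s
    · rw [VectorMeasure.map_apply _ hf hs]
      exact E.isPositive _
    · rw [VectorMeasure.not_measurable _ hs]
      exact ContinuousLinearMap.isPositive_zero
  normalized := by
    rw [VectorMeasure.map_apply _ hf MeasurableSet.univ, Set.preimage_univ]
    exact E.normalized

/-- The linear postprocessing `E_P(s) = E(P⁻¹(s))` of an observable with values in `V`. -/
def postprocess {V W : Type*} [NormedAddCommGroup V] [NormedSpace ℝ V] [FiniteDimensional ℝ V]
    [MeasurableSpace V] [BorelSpace V] [NormedAddCommGroup W] [NormedSpace ℝ W]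
    [MeasurableSpace W] [BorelSpace W] (E : Observable V H) (P : V →ₗ[ℝ] W) : Observable W H :=
  E.map P P.continuous_of_finiteDimensional.measurable

/-- The characteristic function of `E` is `T`: `T(p) = ∫ exp(i⟨p, x⟩) E(dx)` for all `p`. -/
def HasCharFun {V : Type*} [NormedAddCommGroup V] [InnerProductSpace ℝ V] [MeasurableSpace V]
    (E : Observable V H) (T : V → H →L[ℂ] H) : Prop :=
  ∀ p, E.HasIntegral (fun x => Complex.exp (Complex.I * (⟪p, x⟫_ℝ : ℝ))) (T p)

/-- `F = μ * E`, that is, `F(s) = ∫ μ(s - x) E(dx)` for every measurable `s`, where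
`s - x = {y | y + x ∈ s}`. -/
def IsConvolution {V : Type*} [Add V] [MeasurableSpace V]
    (F : Observable V H) (μ : Measure V) (E : Observable V H) : Prop :=
  ∀ s, MeasurableSet s → E.HasIntegral (fun x => (μ.real {y | y + x ∈ s} : ℂ)) (F.effect s)

/-- `F` is a Gaussian smearing of `E`: `F = μ * E` for a (possibly degenerate) Gaussian
probability measure `μ`. -/
def IsGaussianSmearing {V : Type*} [NormedAddCommGroup V] [NormedSpace ℝ V] [MeasurableSpace V]
    (F E : Observable V H) : Prop :=
  ∃ μ : Measure V, ProbabilityTheory.IsGaussian μ ∧ F.IsConvolution μ E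

end Observable

end Hilbert

/-! ### Weyl operators of `N` bosonic modes -/

/-- The Hilbert space `L²(ℝᴺ)` of `N` bosonic modes in the coordinate representation. -/
abbrev ModeSpace (N : ℕ) : Type :=
  Lp ℂ 2 (volume : Measure (EuclideanSpace ℝ (Fin N)))

/-- The phase space `ℝ²ᴺ`; the coordinate `(0, j)` is `q_j` and the coordinate `(1, j)` is `p_j`. -/
abbrev PhaseSpace (N : ℕ) : Type := EuclideanSpace ℝ (Fin 2 × Fin N)

/-- The symplectic matrix `Ω = ⨁_j ω_j` with `ω_j = !![0, 1; -1, 0]`. -/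
def symplecticMatrix (N : ℕ) : Matrix (Fin 2 × Fin N) (Fin 2 × Fin N) ℝ :=
  Matrix.blockDiagonal fun _ => !![0, 1; -1, 0]

/-- The position part `(q_1, …, q_N)` of a phase space point. -/
def posPart {N : ℕ} (x : PhaseSpace N) : EuclideanSpace ℝ (Fin N) :=
  WithLp.toLp 2 fun j => x (0, j)

/-- The momentum part `(p_1, …, p_N)` of a phase space point. -/
def momPart {N : ℕ} (x : PhaseSpace N) : EuclideanSpace ℝ (Fin N) :=
  WithLp.toLp 2 fun j => x (1, j)

/-- The phase `exp(i (p · t - q · p / 2))` for `x = (q, p)`. -/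
def weylPhase {N : ℕ} (x : PhaseSpace N) (t : EuclideanSpace ℝ (Fin N)) : ℂ :=
  Complex.exp (Complex.I *
    ((⟪momPart x, t⟫_ℝ - ⟪posPart x, momPart x⟫_ℝ / 2 : ℝ) : ℂ))

lemma norm_weylPhase {N : ℕ} (x : PhaseSpace N) (t : EuclideanSpace ℝ (Fin N)) :
    ‖weylPhase x t‖ = 1 := by
  rw [weylPhase, mul_comm]
  exact Complex.norm_exp_ofReal_mul_I _

lemma continuous_weylPhase {N : ℕ} (x : PhaseSpace N) : Continuous (weylPhase x) := by
  unfold weylPhase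
  fun_prop

lemma memLp_weylPhase_mul {N : ℕ} (x : PhaseSpace N) (ψ : ModeSpace N) :
    MemLp (fun t => weylPhase x t * ψ t) 2 volume := by
  refine (Lp.memLp ψ).of_le
    ((continuous_weylPhase x).aestronglyMeasurable.mul (Lp.aestronglyMeasurable ψ)) ?_
  filter_upwards with t
  rw [norm_mul, norm_weylPhase, one_mul]

/-- Multiplication by the phase of the Weyl operator, as an isometry of `L²(ℝᴺ)`. -/
def weylPhaseIsometry {N : ℕ} (x : PhaseSpace N) : ModeSpace N →ₗᵢ[ℂ] ModeSpace N where
  toFun ψ := (memLp_weylPhase_mul x ψ).toLp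
  map_add' ψ χ := by
    rw [← MemLp.toLp_add]
    refine MemLp.toLp_congr _ _ ?_
    filter_upwards [Lp.coeFn_add ψ χ] with t ht
    rw [ht, Pi.add_apply, Pi.add_apply, mul_add]
  map_smul' c ψ := by
    rw [RingHom.id_apply, ← MemLp.toLp_const_smul]
    refine MemLp.toLp_congr _ _ ?_
    filter_upwards [Lp.coeFn_smul c ψ] with t ht
    simp only [ht, Pi.smul_apply, smul_eq_mul]
    ring
  norm_map' ψ := by
    rw [LinearMap.coe_mk, AddHom.coe_mk, Lp.norm_def, Lp.norm_def]
    congr 1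
    refine eLpNorm_congr_norm_ae ?_
    filter_upwards [(memLp_weylPhase_mul x ψ).coeFn_toLp] with t ht
    rw [ht, norm_mul, norm_weylPhase, one_mul]

/-- The Weyl operator `W(x) = exp(-i xᵀ Ω R) = exp(i ∑_j (p_j Q_j - q_j P_j))` at `x = (q, p)`,
where `Q_j` is multiplication by `t_j` and `P_j = -i ∂/∂t_j`. In the coordinate representation
`(W(x) ψ)(t) = exp(i (p · t - q · p / 2)) ψ(t - q)`. -/
def weyl {N : ℕ} (x : PhaseSpace N) : ModeSpace N →L[ℂ] ModeSpace N :=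
  (weylPhaseIsometry x).toContinuousLinearMap ∘L
    (Lp.compMeasurePreservingₗᵢ ℂ (fun t => t - posPart x)
      (measurePreserving_sub_right volume (posPart x))).toContinuousLinearMap

/-! ### Gaussian observables and generalized quadratures -/

/-- `E : 𝓑(ℝ^ι) → 𝓛(L²(ℝᴺ))` is the Gaussian observable with parameters `(A, B, v)`:
`B - i Aᵀ Ω A ≥ 0` and the characteristic function of `E` is
`p ↦ exp(-¼ pᵀ B p - i vᵀ p) W(A p)`. -/
def IsGaussianWith {N : ℕ} {ι : Type*} [Fintype ι]
    (E : Observable (EuclideanSpace ℝ ι) (ModeSpace N))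
    (A : Matrix (Fin 2 × Fin N) ι ℝ) (B : Matrix ι ι ℝ) (v : ι → ℝ) : Prop :=
  (B.map Complex.ofReal -
      Complex.I • (A.transpose * symplecticMatrix N * A).map Complex.ofReal).PosSemidef ∧
    E.HasCharFun fun p =>
      Complex.exp (-(1 / 4) * ((p.ofLp ⬝ᵥ B.mulVec p.ofLp : ℝ) : ℂ) -
          Complex.I * ((v ⬝ᵥ p.ofLp : ℝ) : ℂ)) •
        weyl (WithLp.toLp 2 (A.mulVec p.ofLp))

/-- Gaussian observables with outcome space `ℝ^ι`. -/
def IsGaussianObservable {N : ℕ} {ι : Type*} [Fintype ι]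
    (E : Observable (EuclideanSpace ℝ ι) (ModeSpace N)) : Prop :=
  ∃ A B v, IsGaussianWith E A B v

/-- `Q` is the generalized quadrature `Q_a`: the sharp real-valued observable with characteristic
function `p ↦ W(p a) = exp(i p (-aᵀ Ω R))`, that is, the spectral measure of `-aᵀ Ω R`. -/
def IsQuadratureOf {N : ℕ} (a : PhaseSpace N) (Q : Observable ℝ (ModeSpace N)) : Prop :=
  Q.IsSharp ∧ Q.HasCharFun fun p => weyl (p • a)

/-- The set `{Q_a | a ∈ ℝ²ᴺ}` of generalized quadratures. -/
def generalizedQuadratures (N : ℕ) : Set (Observable ℝ (ModeSpace N)) :=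
  {Q | ∃ a : PhaseSpace N, IsQuadratureOf a Q}

end GaussianObs

end

/-! Both conditions are equivalent to invertibility of the matrix `A` for which the characteristic
function of `E` is a nowhere vanishing scalar times `W(A p)`. The scalar can always be divided out,
so only the range and the kernel of `A` matter.

If `A` is invertible, the outcome distribution of a state ρ determines tr[ρ W(x)] for every x, and
this Weyl transform determines ρ (`comp_self_eq_of_weyl`). Indeed, write ρ = R² with R
Hilbert–Schmidt, so that ρ = ∑ |fᵢ⟩⟨fᵢ| with fᵢ = R eᵢ. Up to a phase and a rescaling of the
momentum, p ↦ ⟨f, W(q, p) f⟩ is the Fourier transform of t ↦ conj (f t) * f (t - q), so the Weyl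
transform fixes the integral kernel of ρ along each shifted diagonal, and integrating over q gives
its matrix elements between test functions.

If `A` is singular, a left null vector yields y ≠ 0 symplectically orthogonal to the range of `A`.
By the commutation relations W(y) commutes with every W(A p), so φ and W(y)φ have the same
statistics. Informational completeness would make every vector an eigenvector of W(y), which is
impossible because some W(z) anticommutes with W(y)
(`IsGaussianWith.det_ne_zero_of_informationallyComplete`).

On the side of marginals, the functional P = ⟨c, ·⟩ gives a Gaussian smearing of the quadrature
along `A c`, and of no other quadrature, since proportional Weyl operators coincide
(`eq_of_smul_weyl_eq`). The map Φ is therefore forced to be c ↦ `A c` followed by a ↦ Q_a. The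
latter is bijective, by existence (`exists_isQuadratureOf`) and by uniqueness of quadratures, so Φ
is bijective exactly when `A` is. -/

open MeasureTheory
open scoped InnerProductSpace ENNReal ComplexOrder

noncomputable section

namespace GaussianObs

/-! ### The scalar measures of an observable -/

/-- A bounded operator is determined by its quadratic form. -/
lemma clm_ext_inner {H : Type*} [NormedAddCommGroup H] [InnerProductSpace ℂ H]
    {S T : H →L[ℂ] H} (h : ∀ φ, ⟪φ, S φ⟫_ℂ = ⟪φ, T φ⟫_ℂ) : S = T := by
  have : (S : H →ₗ[ℂ] H) = T := by
    refine (ext_inner_map _ _).mp fun φ => ?_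
    have := congrArg (starRingEnd ℂ) (h φ)
    rwa [inner_conj_symm, inner_conj_symm] at this
  exact ContinuousLinearMap.coe_injective this

namespace Observable

variable {H : Type*} [NormedAddCommGroup H] [InnerProductSpace ℂ H] [CompleteSpace H]
variable {X Y : Type*} [MeasurableSpace X] [MeasurableSpace Y]

lemma diagMeasure_apply (E : Observable X H) (φ : H) {s : Set X} (hs : MeasurableSet s) :
    E.diagMeasure φ s = ENNReal.ofReal (⟪φ, E.effect s φ⟫_ℂ).re :=
  Measure.ofMeasurable_apply s hs

instance (E : Observable X H) (φ : H) : IsFiniteMeasure (E.diagMeasure φ) where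
  measure_univ_lt_top := by
    rw [diagMeasure_apply E φ MeasurableSet.univ]
    exact ENNReal.ofReal_lt_top

lemma effect_univ (E : Observable X H) : E.effect Set.univ = ContinuousLinearMap.id ℂ H :=
  E.normalized

lemma inner_effect_eq (E : Observable X H) (φ : H) {s : Set X} (hs : MeasurableSet s) :
    ⟪φ, E.effect s φ⟫_ℂ = ((E.diagMeasure φ).real s : ℂ) := by
  have h := (E.effect_isPositive s).inner_nonneg_right φ
  rw [Measure.real, diagMeasure_apply E φ hs,
    ENNReal.toReal_ofReal (Complex.nonneg_iff.mp h).1]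
  exact Complex.ext rfl (by simpa using (Complex.nonneg_iff.mp h).2.symm)

lemma diagMeasure_univ (E : Observable X H) (φ : H) :
    E.diagMeasure φ Set.univ = ENNReal.ofReal (‖φ‖ ^ 2) := by
  rw [diagMeasure_apply E φ MeasurableSet.univ, effect_univ, ContinuousLinearMap.id_apply,
    inner_self_eq_norm_sq_to_K]
  norm_cast

/-- An observable is determined by its scalar measures. -/
lemma ext_diagMeasure {E F : Observable X H} (h : ∀ φ, E.diagMeasure φ = F.diagMeasure φ) :
    E = F := by
  have hm : E.toVectorMeasure = F.toVectorMeasure := by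
    refine VectorMeasure.ext fun s hs => ?_
    have : E.effect s = F.effect s := clm_ext_inner fun φ => by
      rw [inner_effect_eq E φ hs, inner_effect_eq F φ hs, h φ]
    ext φ ψ
    exact congrArg (fun T : H →L[ℂ] H => ⟪ψ, T φ⟫_ℂ) this
  cases E
  cases F
  cases hm
  rfl

lemma diagMeasure_map (E : Observable X H) (f : X → Y) (hf : Measurable f) (φ : H) :
    (E.map f hf).diagMeasure φ = (E.diagMeasure φ).map f := by
  ext s hs
  rw [diagMeasure_apply _ φ hs, Measure.map_apply hf hs, diagMeasure_apply E φ (hf hs)]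
  simp only [effect, map, VectorMeasure.map_apply _ hf hs]

/-- A convolution of observables is a convolution of the scalar measures. -/
lemma isConvolution_iff {V : Type*} [NormedAddCommGroup V] [MeasurableSpace V] [BorelSpace V]
    [SecondCountableTopology V] {E F : Observable V H} {μ : Measure V} [IsProbabilityMeasure μ] :
    F.IsConvolution μ E ↔ ∀ φ, F.diagMeasure φ = μ.conv (E.diagMeasure φ) := by
  have key : ∀ φ, ∀ s, MeasurableSet s →
      ∫ x, (μ.real {y | y + x ∈ s} : ℂ) ∂(E.diagMeasure φ)
        = ((μ.conv (E.diagMeasure φ)).real s : ℂ) := by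
    intro φ s hs
    have hmeas : Measurable fun x => μ {y | y + x ∈ s} := by
      have hs' : MeasurableSet ((fun z : V × V => z.1 + z.2) ⁻¹' s) := measurable_add hs
      exact measurable_measure_prodMk_right hs'
    have h1 : (μ.conv (E.diagMeasure φ)) s = ∫⁻ x, μ {y | y + x ∈ s} ∂(E.diagMeasure φ) := by
      rw [Measure.conv, Measure.map_apply measurable_add hs,
        Measure.prod_apply_symm (measurable_add hs)]
      rfl
    rw [integral_complex_ofReal, Measure.real, h1]
    congr 1
    exact integral_toReal hmeas.aemeasurable (by simp)
  constructor
  · intro h φ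
    ext s hs
    have := h s hs φ
    rw [key φ s hs, inner_effect_eq F φ hs] at this
    rw [← measureReal_eq_measureReal_iff]
    exact_mod_cast this
  · intro h s hs φ
    rw [key φ s hs, inner_effect_eq F φ hs, h φ]

section CharFun

variable {V : Type*} [NormedAddCommGroup V] [InnerProductSpace ℝ V] [MeasurableSpace V]

/-- This identity reduces operator-valued characteristic functions to those of finite scalar
measures, for which Fourier uniqueness is available. -/
lemma HasCharFun.charFun_diagMeasure {E : Observable V H} {T : V → H →L[ℂ] H}
    (h : E.HasCharFun T) (φ : H) (p : V) :
    charFun (E.diagMeasure φ) p = ⟪φ, T p φ⟫_ℂ := by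
  rw [h p φ, charFun_apply]
  refine integral_congr_ae (Filter.Eventually.of_forall fun x => ?_)
  simp only [real_inner_comm, mul_comm]

variable [BorelSpace V] [CompleteSpace V] [SecondCountableTopology V]

/-- An observable is determined by its characteristic function. -/
lemma HasCharFun.unique {E F : Observable V H} {T : V → H →L[ℂ] H}
    (hE : E.HasCharFun T) (hF : F.HasCharFun T) : E = F :=
  ext_diagMeasure fun φ => Measure.ext_of_charFun <| funext fun p => by
    rw [hE.charFun_diagMeasure, hF.charFun_diagMeasure]

end CharFun

end Observable

/-! ### Weyl operators -/

section Weyl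

variable {N : ℕ}

@[simp] lemma posPart_apply (x : PhaseSpace N) (j : Fin N) : posPart x j = x (0, j) := rfl

@[simp] lemma momPart_apply (x : PhaseSpace N) (j : Fin N) : momPart x j = x (1, j) := rfl

lemma posPart_smul (s : ℝ) (x : PhaseSpace N) : posPart (s • x) = s • posPart x := rfl

lemma momPart_smul (s : ℝ) (x : PhaseSpace N) : momPart (s • x) = s • momPart x := rfl

lemma posPart_sub (x y : PhaseSpace N) : posPart (x - y) = posPart x - posPart y := rfl

lemma momPart_sub (x y : PhaseSpace N) : momPart (x - y) = momPart x - momPart y := rfl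

/-- The phase space point with position part `q` and momentum part `p`. -/
def phasePoint (q p : EuclideanSpace ℝ (Fin N)) : PhaseSpace N :=
  WithLp.toLp 2 fun k => if k.1 = 0 then q k.2 else p k.2

@[simp] lemma posPart_phasePoint (q p : EuclideanSpace ℝ (Fin N)) :
    posPart (phasePoint q p) = q := by
  ext j; simp [phasePoint]

@[simp] lemma momPart_phasePoint (q p : EuclideanSpace ℝ (Fin N)) :
    momPart (phasePoint q p) = p := by
  ext j; simp [phasePoint]

lemma inner_eq_posPart_add_momPart (x y : PhaseSpace N) :
    ⟪x, y⟫_ℝ = ⟪posPart x, posPart y⟫_ℝ + ⟪momPart x, momPart y⟫_ℝ := by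
  simp [PiLp.inner_apply, Fintype.sum_prod_type]

/-- The symplectic form on phase space. -/
def symp (x y : PhaseSpace N) : ℝ := ⟪momPart x, posPart y⟫_ℝ - ⟪posPart x, momPart y⟫_ℝ

lemma symp_sub_left (x y z : PhaseSpace N) : symp (x - y) z = symp x z - symp y z := by
  simp only [symp, posPart_sub, momPart_sub, inner_sub_left]
  ring

/-- The Riesz representation of linear functionals by the symplectic form. -/
lemma symp_phasePoint_left (w x : PhaseSpace N) :
    symp (phasePoint (-momPart w) (posPart w)) x = ⟪w, x⟫_ℝ := by
  rw [inner_eq_posPart_add_momPart, symp, posPart_phasePoint, momPart_phasePoint, inner_neg_left]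
  ring

lemma exists_symp_eq {x : PhaseSpace N} (hx : x ≠ 0) (r : ℝ) : ∃ z, symp x z = r := by
  have hx' : ⟪x, x⟫_ℝ ≠ 0 := by simpa using hx
  -- The form pairs x = (q, p) with (p, -q) to |q|² + |p|², so rescaling this vector reaches every
  -- r.
  refine ⟨(r / ⟪x, x⟫_ℝ) • phasePoint (momPart x) (-posPart x), ?_⟩
  simp only [symp, posPart_smul, momPart_smul, posPart_phasePoint, momPart_phasePoint,
    inner_smul_right, inner_neg_right]
  rw [inner_eq_posPart_add_momPart] at hx' ⊢
  field_simp
  ring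

lemma weyl_coeFn (x : PhaseSpace N) (ψ : ModeSpace N) :
    weyl x ψ =ᵐ[volume] fun t => weylPhase x t * ψ (t - posPart x) := by
  have hmp := measurePreserving_sub_right (volume : Measure (EuclideanSpace ℝ (Fin N))) (posPart x)
  have h1 := (memLp_weylPhase_mul x
    (Lp.compMeasurePreserving (fun t => t - posPart x) hmp ψ)).coeFn_toLp
  have h2 := Lp.coeFn_compMeasurePreserving ψ hmp
  filter_upwards [h1, h2] with t ht1 ht2
  refine ht1.trans ?_
  rw [ht2]
  rfl

/-- The Weyl operator as an isometry. -/
def weylIsometry (x : PhaseSpace N) : ModeSpace N →ₗᵢ[ℂ] ModeSpace N :=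
  (weylPhaseIsometry x).comp (Lp.compMeasurePreservingₗᵢ ℂ (fun t => t - posPart x)
      (measurePreserving_sub_right volume (posPart x)))

lemma norm_weyl_apply (x : PhaseSpace N) (ψ : ModeSpace N) : ‖weyl x ψ‖ = ‖ψ‖ :=
  (weylIsometry x).norm_map ψ

lemma inner_weyl_weyl (x : PhaseSpace N) (φ ψ : ModeSpace N) :
    ⟪weyl x φ, weyl x ψ⟫_ℂ = ⟪φ, ψ⟫_ℂ :=
  (weylIsometry x).inner_map_map φ ψ

/-- The canonical commutation relations in Weyl form. -/
lemma weyl_comm (x y : PhaseSpace N) (ψ : ModeSpace N) :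
    weyl x (weyl y ψ) = Complex.exp (Complex.I * symp x y) • weyl y (weyl x ψ) := by
  refine Lp.ext ?_
  have hx := (measurePreserving_sub_right (volume : Measure (EuclideanSpace ℝ (Fin N)))
    (posPart x)).quasiMeasurePreserving.ae (weyl_coeFn y ψ)
  have hy := (measurePreserving_sub_right (volume : Measure (EuclideanSpace ℝ (Fin N)))
    (posPart y)).quasiMeasurePreserving.ae (weyl_coeFn x ψ)
  filter_upwards [weyl_coeFn x (weyl y ψ), weyl_coeFn y (weyl x ψ), hx, hy,
    Lp.coeFn_smul (Complex.exp (Complex.I * symp x y)) (weyl y (weyl x ψ))] with t h1 h2 h3 h4 h5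
  rw [h1, h5, Pi.smul_apply, h2, h3, h4, smul_eq_mul, sub_right_comm, ← mul_assoc, ← mul_assoc,
    ← mul_assoc]
  congr 1
  simp only [weylPhase, ← Complex.exp_add, symp, inner_sub_right,
    real_inner_comm (posPart x) (momPart y)]
  congr 1
  push_cast
  ring

/-- The indicator of the unit ball has positive norm, also for N = 0, where the space is a point of
positive measure. -/
instance : Nontrivial (ModeSpace N) := by
  refine nontrivial_of_ne (indicatorConstLp 2
    (Metric.isOpen_ball (x := (0 : EuclideanSpace ℝ (Fin N))) (ε := 1)).measurableSet
    measure_ball_lt_top.ne (1 : ℂ)) 0 fun h => ?_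
  have h2 := congrArg norm h
  rw [norm_indicatorConstLp (by norm_num) (by norm_num), norm_zero, norm_one, one_mul] at h2
  have hpos : 0 < volume.real (Metric.ball (0 : EuclideanSpace ℝ (Fin N)) 1) :=
    ENNReal.toReal_pos (Metric.measure_ball_pos volume _ one_pos).ne' measure_ball_lt_top.ne
  exact (Real.rpow_pos_of_pos hpos _).ne' h2

/-- Proportional Weyl operators coincide. -/
lemma eq_of_smul_weyl_eq {c d : ℂ} (hc : c ≠ 0) {x y : PhaseSpace N}
    (h : c • weyl x = d • weyl y) : x = y := by
  by_contra hxy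
  -- Moving W(z) through W(x) and through W(y) produces phases whose ratio is exp(iπ) = -1, whereas
  -- proportionality forces the two phases to agree.
  obtain ⟨z, hz⟩ := exists_symp_eq (sub_ne_zero.mpr hxy) Real.pi
  obtain ⟨ψ, hψ⟩ := exists_ne (0 : ModeSpace N)
  have happ : ∀ χ, c • weyl x χ = d • weyl y χ := fun χ => DFunLike.congr_fun h χ
  have h1 := happ (weyl z ψ)
  rw [weyl_comm x z, weyl_comm y z, smul_comm c, smul_comm d, ← map_smul (weyl z) c,
    ← map_smul (weyl z) d,
    ← happ ψ] at h1
  have hne : weyl z (c • weyl x ψ) ≠ 0 := by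
    rw [← norm_ne_zero_iff, norm_weyl_apply, norm_smul, norm_weyl_apply]
    simp [hc, hψ]
  have h2 := smul_left_injective ℂ hne h1
  rw [symp_sub_left] at hz
  have h3 : Complex.exp (Real.pi * Complex.I) = 1 := by
    rw [← hz, Complex.ofReal_sub, sub_mul, Complex.exp_sub, mul_comm, h2, mul_comm]
    exact div_self (Complex.exp_ne_zero _)
  rw [Complex.exp_pi_mul_I] at h3
  norm_num at h3

end Weyl

/-! ### Spectral measures of multiplication operators -/

section Multiplication

variable {α : Type*} [MeasurableSpace α] {μ : Measure α}

/-- Multiplication by the indicator function of a measurable set on `L²`. -/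
def indicatorCLM (μ : Measure α) {s : Set α} (hs : MeasurableSet s) :
    Lp ℂ 2 μ →L[ℂ] Lp ℂ 2 μ :=
  LinearMap.mkContinuous
    { toFun := fun ψ => ((Lp.memLp ψ).indicator hs).toLp
      map_add' := fun ψ χ => by
        rw [← MemLp.toLp_add]
        refine MemLp.toLp_congr _ _ ?_
        filter_upwards [Lp.coeFn_add ψ χ] with t ht
        by_cases h : t ∈ s
        · simpa only [Set.indicator_of_mem h, Pi.add_apply] using ht
        · simp [h]
      map_smul' := fun c ψ => by
        rw [RingHom.id_apply, ← MemLp.toLp_const_smul]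
        refine MemLp.toLp_congr _ _ ?_
        filter_upwards [Lp.coeFn_smul c ψ] with t ht
        by_cases h : t ∈ s
        · simpa only [Set.indicator_of_mem h, Pi.smul_apply] using ht
        · simp [h] }
    1 fun ψ => by
      rw [one_mul, LinearMap.coe_mk, AddHom.coe_mk, Lp.norm_toLp]
      exact ENNReal.toReal_mono (Lp.memLp ψ).2.ne (eLpNorm_indicator_le _)

lemma indicatorCLM_coeFn {s : Set α} (hs : MeasurableSet s) (ψ : Lp ℂ 2 μ) :
    indicatorCLM μ hs ψ =ᵐ[μ] s.indicator ψ :=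
  ((Lp.memLp ψ).indicator hs).coeFn_toLp

lemma inner_indicatorCLM {s : Set α} (hs : MeasurableSet s) (φ ψ : Lp ℂ 2 μ) :
    ⟪φ, indicatorCLM μ hs ψ⟫_ℂ = ∫ t in s, ⟪φ t, ψ t⟫_ℂ ∂μ := by
  rw [L2.inner_def, ← integral_indicator hs]
  refine integral_congr_ae ?_
  filter_upwards [indicatorCLM_coeFn hs ψ] with t ht
  rw [ht]
  by_cases h : t ∈ s <;> simp [h]

variable {H : Type*} [NormedAddCommGroup H] [InnerProductSpace ℂ H]
variable {Y : Type*} [MeasurableSpace Y]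

/-- The effects of the spectral measure of multiplication by `f`, transported along a unitary. -/
def mulEffect (U : H ≃ₗᵢ[ℂ] Lp ℂ 2 μ) {f : α → Y} (hf : Measurable f) {s : Set Y}
    (hs : MeasurableSet s) : H →L[ℂ] H :=
  (U.symm : Lp ℂ 2 μ →L[ℂ] H) ∘L indicatorCLM μ (hf hs) ∘L (U : H →L[ℂ] Lp ℂ 2 μ)

lemma inner_mulEffect (U : H ≃ₗᵢ[ℂ] Lp ℂ 2 μ) {f : α → Y} (hf : Measurable f) {s : Set Y}
    (hs : MeasurableSet s) (φ ψ : H) :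
    ⟪φ, mulEffect U hf hs ψ⟫_ℂ = ∫ t in f ⁻¹' s, ⟪U φ t, U ψ t⟫_ℂ ∂μ := by
  rw [← inner_indicatorCLM (hf hs), ← U.inner_map_map]
  simp [mulEffect]

lemma mulEffect_isPositive (U : H ≃ₗᵢ[ℂ] Lp ℂ 2 μ) {f : α → Y} (hf : Measurable f) {s : Set Y}
    (hs : MeasurableSet s) : (mulEffect U hf hs).IsPositive := by
  rw [ContinuousLinearMap.isPositive_iff_complex]
  intro φ
  have h : ⟪φ, mulEffect U hf hs φ⟫_ℂ = ((∫ t in f ⁻¹' s, ‖U φ t‖ ^ 2 ∂μ : ℝ) : ℂ) := by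
    rw [inner_mulEffect, ← integral_complex_ofReal]
    refine integral_congr_ae (Filter.Eventually.of_forall fun t => ?_)
    simp only [inner_self_eq_norm_sq_to_K]
    norm_cast
  rw [← inner_conj_symm, h, Complex.conj_ofReal]
  refine ⟨rfl, ?_⟩
  rw [RCLike.re_eq_complex_re, Complex.ofReal_re]
  positivity

variable [CompleteSpace H]

open Classical in
/-- The spectral measure of multiplication by `f`, transported along a unitary. -/
def mulObservable (U : H ≃ₗᵢ[ℂ] Lp ℂ 2 μ) {f : α → Y} (hf : Measurable f) : Observable Y H where
  toVectorMeasure :=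
    { measureOf' := fun s =>
        if hs : MeasurableSet s then ContinuousLinearMapWOT.ofCLM (mulEffect U hf hs) else 0
      empty' := by
        rw [dif_pos MeasurableSet.empty]
        refine ContinuousLinearMapWOT.ext_inner fun φ ψ => ?_
        have := inner_mulEffect U hf MeasurableSet.empty ψ φ
        simpa using this
      not_measurable' := fun s hs => dif_neg hs
      m_iUnion' := fun g hg hd => by
        simp only [hg, MeasurableSet.iUnion hg, dif_pos]
        refine ContinuousLinearMapWOT.tendsto_iff_forall_inner_apply_tendsto.mpr fun ψ φ => ?_
        have h := hasSum_integral_iUnion (μ := μ) (f := fun t => ⟪U φ t, U ψ t⟫_ℂ)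
          (fun i => hf (hg i)) (fun i j hij => (hd hij).preimage f)
          (L2.integrable_inner (U φ) (U ψ)).integrableOn
        have e : ⟪φ, (ContinuousLinearMapWOT.ofCLM (mulEffect U hf (MeasurableSet.iUnion hg)) :
            H →WOT[ℂ] H) ψ⟫_ℂ = ∫ t in ⋃ i, f ⁻¹' g i, ⟪U φ t, U ψ t⟫_ℂ ∂μ := by
          rw [← Set.preimage_iUnion]
          exact inner_mulEffect U hf (MeasurableSet.iUnion hg) φ ψ
        rw [e]
        refine h.congr fun S => ?_
        induction S using Finset.cons_induction with
        | empty => simp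
        | cons a S ha ih =>
          rw [Finset.sum_cons, Finset.sum_cons, ContinuousLinearMapWOT.add_apply, inner_add_right,
            ← ih]
          congr 1
          exact (inner_mulEffect U hf (hg a) φ ψ).symm }
  isPositive s := by
    by_cases hs : MeasurableSet s
    · change ContinuousLinearMap.IsPositive (ContinuousLinearMapWOT.toCLM (dite _ _ _))
      rw [dif_pos hs]
      exact mulEffect_isPositive U hf hs
    · change ContinuousLinearMap.IsPositive (ContinuousLinearMapWOT.toCLM (dite _ _ _))
      rw [dif_neg hs]
      exact ContinuousLinearMap.isPositive_zero
  normalized := by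
    change ContinuousLinearMapWOT.toCLM (dite _ _ _) = _
    rw [dif_pos MeasurableSet.univ]
    refine clm_ext_inner fun φ => ?_
    have := inner_mulEffect U hf MeasurableSet.univ φ φ
    rw [Set.preimage_univ, Measure.restrict_univ, ← L2.inner_def, U.inner_map_map] at this
    exact this

lemma mulObservable_effect (U : H ≃ₗᵢ[ℂ] Lp ℂ 2 μ) {f : α → Y} (hf : Measurable f) {s : Set Y}
    (hs : MeasurableSet s) : (mulObservable U hf).effect s = mulEffect U hf hs :=
  congrArg ContinuousLinearMapWOT.toCLM (dif_pos hs)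

lemma mulObservable_isSharp (U : H ≃ₗᵢ[ℂ] Lp ℂ 2 μ) {f : α → Y} (hf : Measurable f) :
    (mulObservable U hf).IsSharp := by
  intro s t hs ht
  rw [mulObservable_effect U hf hs, mulObservable_effect U hf ht,
    mulObservable_effect U hf (hs.inter ht)]
  ext1 ψ
  simp only [mulEffect, ContinuousLinearMap.comp_apply]
  change U.symm (indicatorCLM μ _ (U (U.symm (indicatorCLM μ _ (U ψ))))) =
    U.symm (indicatorCLM μ _ (U ψ))
  rw [U.apply_symm_apply]
  congr 1
  refine Lp.ext ?_
  filter_upwards [indicatorCLM_coeFn (hf hs) (indicatorCLM μ (hf ht) (U ψ)),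
    indicatorCLM_coeFn (hf ht) (U ψ), indicatorCLM_coeFn (hf (hs.inter ht)) (U ψ)] with x h1 h2 h3
  rw [h1, h3]
  by_cases hxs : f x ∈ s <;> by_cases hxt : f x ∈ t <;> simp [h2, hxs, hxt]

lemma mulObservable_diagMeasure (U : H ≃ₗᵢ[ℂ] Lp ℂ 2 μ) {f : α → Y} (hf : Measurable f) (φ : H) :
    (mulObservable U hf).diagMeasure φ =
      (μ.withDensity fun t => ENNReal.ofReal (‖U φ t‖ ^ 2)).map f := by
  ext s hs
  have hint : Integrable (fun t => ‖U φ t‖ ^ 2) μ :=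
    (Lp.memLp (U φ)).integrable_norm_pow two_ne_zero
  rw [Observable.diagMeasure_apply _ φ hs, Measure.map_apply hf hs, withDensity_apply _ (hf hs),
    mulObservable_effect U hf hs, inner_mulEffect,
    ← ofReal_integral_eq_lintegral_ofReal hint.integrableOn
      (Filter.Eventually.of_forall fun t => by positivity)]
  congr 1
  rw [← Complex.ofReal_re (∫ t in f ⁻¹' s, ‖U φ t‖ ^ 2 ∂μ), ← integral_complex_ofReal]
  congr 1
  refine integral_congr_ae (Filter.Eventually.of_forall fun t => ?_)
  simp only [inner_self_eq_norm_sq_to_K]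
  norm_cast

/-- The characteristic function of the spectral measure of a real multiplication operator. -/
lemma mulObservable_hasCharFun (U : H ≃ₗᵢ[ℂ] Lp ℂ 2 μ) {f : α → ℝ} (hf : Measurable f)
    {T : ℝ → H →L[ℂ] H}
    (hT : ∀ p φ, U (T p φ) =ᵐ[μ] fun t => Complex.exp (Complex.I * (p * f t : ℝ)) * U φ t) :
    (mulObservable U hf).HasCharFun T := by
  intro p φ
  have hmeas : AEMeasurable (fun t => ENNReal.ofReal (‖U φ t‖ ^ 2)) μ :=
    ((Lp.aestronglyMeasurable (U φ)).norm.aemeasurable.pow_const 2).ennreal_ofReal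
  rw [mulObservable_diagMeasure, integral_map hf.aemeasurable
      (Measurable.aestronglyMeasurable (by fun_prop)),
    integral_withDensity_eq_integral_toReal_smul₀ hmeas
      (Filter.Eventually.of_forall fun t => ENNReal.ofReal_lt_top),
    ← U.inner_map_map, L2.inner_def]
  refine integral_congr_ae ?_
  filter_upwards [hT p φ] with t ht
  rw [ht, ENNReal.toReal_ofReal (by positivity), real_inner_comm, ← smul_eq_mul, inner_smul_right,
    inner_self_eq_norm_sq_to_K, Complex.real_smul]
  simp [mul_comm]

lemma memLp_phase_mul {θ : α → ℝ} (hθ : Measurable θ) (ψ : Lp ℂ 2 μ) :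
    MemLp (fun t => Complex.exp (Complex.I * θ t) * ψ t) 2 μ := by
  refine (Lp.memLp ψ).of_le
    ((Measurable.aestronglyMeasurable (by fun_prop)).mul (Lp.aestronglyMeasurable ψ)) ?_
  filter_upwards with t
  rw [norm_mul, mul_comm Complex.I, Complex.norm_exp_ofReal_mul_I, one_mul]

/-- Multiplication by the phase `exp(iθ)` as a unitary on `L²`. -/
def phaseMul (μ : Measure α) {θ : α → ℝ} (hθ : Measurable θ) : Lp ℂ 2 μ ≃ₗᵢ[ℂ] Lp ℂ 2 μ :=
  { toFun := fun ψ => (memLp_phase_mul hθ ψ).toLp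
    invFun := fun ψ => (memLp_phase_mul hθ.neg ψ).toLp
    map_add' := fun ψ χ => by
      rw [← MemLp.toLp_add]
      refine MemLp.toLp_congr _ _ ?_
      filter_upwards [Lp.coeFn_add ψ χ] with t ht
      rw [ht, Pi.add_apply, Pi.add_apply, mul_add]
    map_smul' := fun c ψ => by
      rw [RingHom.id_apply, ← MemLp.toLp_const_smul]
      refine MemLp.toLp_congr _ _ ?_
      filter_upwards [Lp.coeFn_smul c ψ] with t ht
      simp only [ht, Pi.smul_apply, smul_eq_mul]
      ring
    left_inv := fun ψ => by
      refine Lp.ext ?_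
      filter_upwards [(memLp_phase_mul hθ ψ).coeFn_toLp,
        (memLp_phase_mul hθ.neg (memLp_phase_mul hθ ψ).toLp).coeFn_toLp] with t h1 h2
      rw [h2, h1, ← mul_assoc, ← Complex.exp_add]
      simp
    right_inv := fun ψ => by
      refine Lp.ext ?_
      filter_upwards [(memLp_phase_mul hθ.neg ψ).coeFn_toLp,
        (memLp_phase_mul hθ (memLp_phase_mul hθ.neg ψ).toLp).coeFn_toLp] with t h1 h2
      rw [h2, h1, ← mul_assoc, ← Complex.exp_add]
      simp
    norm_map' := fun ψ => by
      change ‖(memLp_phase_mul hθ ψ).toLp‖ = ‖ψ‖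
      rw [Lp.norm_def, Lp.norm_def]
      congr 1
      refine eLpNorm_congr_norm_ae ?_
      filter_upwards [(memLp_phase_mul hθ ψ).coeFn_toLp] with t ht
      rw [ht, norm_mul, mul_comm Complex.I, Complex.norm_exp_ofReal_mul_I, one_mul] }

lemma phaseMul_coeFn {θ : α → ℝ} (hθ : Measurable θ) (ψ : Lp ℂ 2 μ) :
    phaseMul μ hθ ψ =ᵐ[μ] fun t => Complex.exp (Complex.I * θ t) * ψ t :=
  (memLp_phase_mul hθ ψ).coeFn_toLp

end Multiplication

/-! ### Existence of generalized quadratures -/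

section Quadratures

open FourierTransform SchwartzMap

/-- The Fourier transform on `L²` turns translations into phases. -/
lemma fourier_translate {V : Type*} [NormedAddCommGroup V] [InnerProductSpace ℝ V]
    [FiniteDimensional ℝ V] [MeasurableSpace V] [BorelSpace V] (a : V)
    (hθ : Measurable fun ξ : V => -2 * Real.pi * ⟪a, ξ⟫_ℝ) (ψ : Lp ℂ 2 (volume : Measure V)) :
    Lp.fourierTransformₗᵢ V ℂ (Lp.compMeasurePreserving (fun t => t - a)
        (measurePreserving_sub_right volume a) ψ) =
      phaseMul volume hθ (Lp.fourierTransformₗᵢ V ℂ ψ) := by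
  -- Both sides are continuous in ψ, so it suffices to treat Schwartz functions, where the Fourier
  -- transform is the classical integral.
  refine (denseRange_toLpCLM (E := V) (F := ℂ) (p := 2) (μ := volume)
    ENNReal.ofNat_ne_top).induction_on (p := fun ψ => Lp.fourierTransformₗᵢ V ℂ
      (Lp.compMeasurePreserving (fun t => t - a) (measurePreserving_sub_right volume a) ψ) =
        phaseMul volume hθ (Lp.fourierTransformₗᵢ V ℂ ψ)) ψ ?_ ?_
  · refine isClosed_eq ?_ ?_
    · exact (Lp.fourierTransformₗᵢ V ℂ).continuous.comp
        (Lp.compMeasurePreservingₗᵢ ℂ (fun t => t - a)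
          (measurePreserving_sub_right volume a)).continuous
    · exact (phaseMul volume hθ).continuous.comp (Lp.fourierTransformₗᵢ V ℂ).continuous
  · intro f
    rw [toLpCLM_apply]
    have h1 : Lp.compMeasurePreserving (fun t => t - a) (measurePreserving_sub_right volume a)
        (f.toLp 2 volume) = (f.compSubConstCLM ℂ a).toLp 2 volume := by
      refine Lp.ext ?_
      have h := (measurePreserving_sub_right (volume : Measure V) a).quasiMeasurePreserving.ae
        (f.coeFn_toLp 2 volume)
      filter_upwards [Lp.coeFn_compMeasurePreserving (f.toLp 2 volume)
        (measurePreserving_sub_right volume a), h, (f.compSubConstCLM ℂ a).coeFn_toLp 2 volume]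
        with t h1 h2 h3
      rw [h1, h3, Function.comp_apply, h2]
      rfl
    rw [h1]
    change 𝓕 ((f.compSubConstCLM ℂ a).toLp 2 volume) = phaseMul volume hθ (𝓕 (f.toLp 2 volume))
    rw [toLp_fourier_eq, toLp_fourier_eq]
    refine Lp.ext ?_
    filter_upwards [(𝓕 (f.compSubConstCLM ℂ a)).coeFn_toLp 2 volume,
      (𝓕 f).coeFn_toLp 2 volume, phaseMul_coeFn hθ ((𝓕 f).toLp 2 volume)] with ξ h1 h2 h3
    rw [h1, h3, h2, fourier_coe, fourier_coe]
    have h4 := congrFun (VectorFourier.fourierIntegral_comp_add_right Real.fourierChar volume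
      (innerₗ V) (f : V → ℂ) (-a)) ξ
    have h5 : (f : V → ℂ) ∘ (fun v => v + -a) = f.compSubConstCLM ℂ a := by
      ext v
      simp [sub_eq_add_neg]
    rw [h5] at h4
    refine h4.trans ?_
    rw [Circle.smul_def, Real.fourierChar_apply, smul_eq_mul]
    congr 2
    simp
    ring

variable {N : ℕ}

/-- The group s ↦ W(s a) is diagonalized explicitly. Without a position part it already consists of
multiplications. Otherwise a quadratic phase removes the momentum part, and the Fourier transform
turns the remaining translations by s q into phases. -/
lemma exists_isQuadratureOf (a : PhaseSpace N) :
    ∃ Q : Observable ℝ (ModeSpace N), IsQuadratureOf a Q := by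
  by_cases hq : posPart a = 0
  · have hf : Measurable fun t : EuclideanSpace ℝ (Fin N) => ⟪momPart a, t⟫_ℝ := by fun_prop
    refine ⟨mulObservable (LinearIsometryEquiv.refl ℂ (ModeSpace N)) hf,
      mulObservable_isSharp _ _, mulObservable_hasCharFun _ _ fun p φ => ?_⟩
    simp only [LinearIsometryEquiv.coe_refl, id_eq]
    filter_upwards [weyl_coeFn (p • a) φ] with t ht
    rw [ht, weylPhase, posPart_smul, momPart_smul, hq]
    simp [inner_smul_left]
  · set q := posPart a with hqdef
    set m := momPart a with hmdef
    have hqq : ⟪q, q⟫_ℝ ≠ 0 := by simpa using hq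
    -- The phase g is a solution of g(t - s q) - g(t) = s ⟨m, t⟩ - s² ⟨q, m⟩ / 2 for all s, which is
    -- what makes multiplication by exp(i g) intertwine W(s a) with translation by s q.
    have hg : Measurable fun t : EuclideanSpace ℝ (Fin N) =>
        -(⟪m, t⟫_ℝ * ⟪q, t⟫_ℝ / ⟪q, q⟫_ℝ
          - ⟪q, m⟫_ℝ * ⟪q, t⟫_ℝ ^ 2 / (2 * ⟪q, q⟫_ℝ ^ 2)) := by fun_prop
    have hf : Measurable fun t : EuclideanSpace ℝ (Fin N) => -2 * Real.pi * ⟪q, t⟫_ℝ := by fun_prop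
    refine ⟨mulObservable ((phaseMul volume hg).trans (Lp.fourierTransformₗᵢ _ ℂ)) hf,
      mulObservable_isSharp _ _, mulObservable_hasCharFun _ _ fun s φ => ?_⟩
    have key : phaseMul volume hg (weyl (s • a) φ) =
        Lp.compMeasurePreserving (fun t => t - s • q) (measurePreserving_sub_right volume (s • q))
          (phaseMul volume hg φ) := by
      refine Lp.ext ?_
      have h := (measurePreserving_sub_right (volume : Measure (EuclideanSpace ℝ (Fin N)))
        (s • q)).quasiMeasurePreserving.ae (phaseMul_coeFn hg φ)
      filter_upwards [phaseMul_coeFn hg (weyl (s • a) φ), weyl_coeFn (s • a) φ,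
        Lp.coeFn_compMeasurePreserving (phaseMul volume hg φ)
          (measurePreserving_sub_right volume (s • q)), h] with t h1 h2 h3 h4
      rw [h1, h2, h3, Function.comp_apply, h4, weylPhase, posPart_smul, momPart_smul, ← hqdef,
        ← hmdef, ← mul_assoc, ← Complex.exp_add, ← mul_add, ← Complex.ofReal_add]
      congr 4
      simp only [inner_sub_right, inner_smul_left, inner_smul_right, conj_trivial,
        real_inner_comm q m]
      field_simp
      ring
    have hθ : Measurable fun ξ : EuclideanSpace ℝ (Fin N) => -2 * Real.pi * ⟪s • q, ξ⟫_ℝ := by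
      fun_prop
    rw [LinearIsometryEquiv.trans_apply, key, fourier_translate (s • q) hθ]
    refine (phaseMul_coeFn hθ _).trans (Filter.Eventually.of_forall fun ξ => ?_)
    simp only [inner_smul_left, conj_trivial, LinearIsometryEquiv.trans_apply]
    congr 4
    ring

end Quadratures

/-! ### Outcome distributions of states -/

section Trace

variable {H : Type*} [NormedAddCommGroup H] [InnerProductSpace ℂ H]

lemma hasSum_norm_inner_sq {ι : Type*} (b : HilbertBasis ι ℂ H) (x : H) :
    HasSum (fun j => ‖⟪b j, x⟫_ℂ‖ ^ 2) (‖x‖ ^ 2) := by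
  have h := Complex.hasSum_re (b.hasSum_inner_mul_inner x x)
  rw [inner_self_eq_norm_sq_to_K] at h
  convert h using 1
  · ext j
    rw [← inner_conj_symm x (b j), Complex.conj_mul']
    norm_cast
  · norm_cast

lemma summable_norm_inner_sq {ι κ : Type*} (b : HilbertBasis ι ℂ H) {g : κ → H}
    (hg : Summable fun i => ‖g i‖ ^ 2) :
    Summable fun x : κ × ι => ‖⟪b x.2, g x.1⟫_ℂ‖ ^ 2 := by
  refine (summable_prod_of_nonneg fun x => by positivity).mpr
    ⟨fun i => (hasSum_norm_inner_sq b (g i)).summable, ?_⟩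
  simpa only [(hasSum_norm_inner_sq b _).tsum_eq] using hg

variable [CompleteSpace H]

/-- Cyclicity of the trace: `tr(R² T) = tr(R T R)` for a self-adjoint Hilbert-Schmidt `R`. -/
lemma tsum_inner_mul_self_comp {ι : Type*} (b : HilbertBasis ι ℂ H) {R : H →L[ℂ] H}
    (hR : ∀ x y, ⟪R x, y⟫_ℂ = ⟪x, R y⟫_ℂ) (hs : Summable fun i => ‖R (b i)‖ ^ 2)
    (T : H →L[ℂ] H) :
    ∑' i, ⟪b i, R (R (T (b i)))⟫_ℂ = ∑' i, ⟪R (b i), T (R (b i))⟫_ℂ := by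
  set T' := ContinuousLinearMap.adjoint T with hT'
  -- Parseval expands each side over the basis: summing F over j gives the terms of the left side,
  -- summing over i those of the right, so the claim is an interchange of summations.
  set F : ι → ι → ℂ := fun i j => ⟪R (b i), b j⟫_ℂ * ⟪b j, R (T (b i))⟫_ℂ with hF
  have hs' : Summable fun i => ‖T' (R (b i))‖ ^ 2 := by
    refine Summable.of_nonneg_of_le (fun i => by positivity) (fun i => ?_) (hs.mul_left (‖T'‖ ^ 2))
    rw [← mul_pow]
    exact pow_le_pow_left₀ (norm_nonneg _) (T'.le_opNorm _) 2
  have e1 : ∀ i j, ⟪b j, R (T (b i))⟫_ℂ = ⟪T' (R (b j)), b i⟫_ℂ := fun i j => by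
    rw [← hR, hT', ContinuousLinearMap.adjoint_inner_left]
  have hsum : Summable (Function.uncurry F) := by
    have h1 := summable_norm_inner_sq b hs
    have h2 := (summable_norm_inner_sq b hs').comp_injective (Prod.swap_injective (α := ι) (β := ι))
    -- Each |F i j| is a product of matrix coefficients of the Hilbert–Schmidt operators R and T' R,
    -- bounded by the sum of their squares.
    refine Summable.of_norm_bounded (h1.add h2) fun x => ?_
    have h3 : ‖⟪b x.2, R (T (b x.1))⟫_ℂ‖ = ‖⟪b x.1, T' (R (b x.2))⟫_ℂ‖ := by
      rw [e1, norm_inner_symm]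
    simp only [Function.uncurry_def, hF, norm_mul, Function.comp_apply, Prod.fst_swap,
      Prod.snd_swap, h3, norm_inner_symm (R (b x.1))]
    nlinarith [sq_nonneg (‖⟪b x.2, R (b x.1)⟫_ℂ‖ - ‖⟪b x.1, T' (R (b x.2))⟫_ℂ‖),
      sq_nonneg ‖⟪b x.2, R (b x.1)⟫_ℂ‖, sq_nonneg ‖⟪b x.1, T' (R (b x.2))⟫_ℂ‖]
  have h1 : ∀ i, ∑' j, F i j = ⟪b i, R (R (T (b i)))⟫_ℂ := fun i => by
    rw [← hR]
    exact b.tsum_inner_mul_inner _ _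
  have h2 : ∀ j, ∑' i, F i j = ⟪R (b j), T (R (b j))⟫_ℂ := fun j => by
    rw [← ContinuousLinearMap.adjoint_inner_left, ← hT', ← b.tsum_inner_mul_inner]
    refine tsum_congr fun i => ?_
    rw [hF]
    simp only
    rw [e1, hR, mul_comm]
  simp_rw [← h1, ← h2]
  exact hsum.tsum_comm.symm

/-- The positive square root of a state. -/
lemma IsState.exists_sqrt {ρ : H →L[ℂ] H} (hρ : IsState ρ) :
    ∃ R : H →L[ℂ] H, (∀ x y, ⟪R x, y⟫_ℂ = ⟪x, R y⟫_ℂ) ∧ R ∘L R = ρ ∧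
      Summable fun i => ‖R (stdBasis H i)‖ ^ 2 := by
  have h0 : 0 ≤ ρ := (ContinuousLinearMap.nonneg_iff_isPositive ρ).mpr hρ.isPositive
  have hsymm : ∀ x y, ⟪CFC.sqrt ρ x, y⟫_ℂ = ⟪x, CFC.sqrt ρ y⟫_ℂ :=
    ((ContinuousLinearMap.nonneg_iff_isPositive _).mp (CFC.sqrt_nonneg ρ)).isSymmetric
  have hsq : CFC.sqrt ρ ∘L CFC.sqrt ρ = ρ := CFC.sqrt_mul_sqrt_self ρ h0
  refine ⟨CFC.sqrt ρ, hsymm, hsq, ?_⟩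
  -- With e the basis, ‖R eᵢ‖² = ⟨eᵢ, ρ eᵢ⟩, so finite trace makes the square root Hilbert–Schmidt.
  refine (Complex.hasSum_re hρ.hasSum_one).summable.congr fun i => ?_
  have h := hsymm (stdBasis H i) (CFC.sqrt ρ (stdBasis H i))
  rw [← ContinuousLinearMap.comp_apply, hsq, inner_self_eq_norm_sq_to_K] at h
  rw [← h]
  norm_cast

namespace Observable

variable {X : Type*} [MeasurableSpace X]

/-- The outcome distribution `s ↦ ∑ᵢ ⟨gᵢ, E(s) gᵢ⟩`. -/
def sumMeasure {ι : Type*} (E : Observable X H) (g : ι → H) : Measure X :=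
  Measure.sum fun i => E.diagMeasure (g i)

lemma isFiniteMeasure_sumMeasure {ι : Type*} (E : Observable X H) {g : ι → H}
    (hg : Summable fun i => ‖g i‖ ^ 2) : IsFiniteMeasure (E.sumMeasure g) := by
  refine ⟨?_⟩
  rw [sumMeasure, Measure.sum_apply _ MeasurableSet.univ]
  simp_rw [diagMeasure_univ]
  rw [← ENNReal.ofReal_tsum_of_nonneg (fun i => by positivity) hg]
  exact ENNReal.ofReal_lt_top

/-- Cyclicity rewrites the trace as a sum of nonnegative terms. Equality of statistics then becomes
equality of two finite measures, hence of their characteristic functions. -/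
lemma prob_eq_sumMeasure (E : Observable X H) {R : H →L[ℂ] H}
    (hR : ∀ x y, ⟪R x, y⟫_ℂ = ⟪x, R y⟫_ℂ) (hs : Summable fun i => ‖R (stdBasis H i)‖ ^ 2)
    {s : Set X} (h : MeasurableSet s) :
    E.prob (R ∘L R) s = ((E.sumMeasure fun i => R (stdBasis H i)).real s : ℂ) := by
  rw [prob, trace]
  simp only [ContinuousLinearMap.comp_apply]
  rw [tsum_inner_mul_self_comp _ hR hs, Measure.real, sumMeasure, Measure.sum_apply _ h,
    ENNReal.tsum_toReal_eq fun i => measure_ne_top _ _, Complex.ofReal_tsum]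
  exact tsum_congr fun i => inner_effect_eq E _ h

/-- The total mass ∑ ‖gᵢ‖² is finite and the integrand unimodular, so the integral against the sum
measure splits termwise. -/
lemma HasCharFun.hasSum_inner {V : Type*} [NormedAddCommGroup V] [InnerProductSpace ℝ V]
    [MeasurableSpace V] [BorelSpace V] [SecondCountableTopology V] {E : Observable V H}
    {T : V → H →L[ℂ] H} (hE : E.HasCharFun T) {ι : Type*} {g : ι → H}
    (hg : Summable fun i => ‖g i‖ ^ 2) (p : V) :
    HasSum (fun i => ⟪g i, T p (g i)⟫_ℂ) (charFun (E.sumMeasure g) p) := by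
  have : IsFiniteMeasure (Measure.sum fun i => E.diagMeasure (g i)) :=
    isFiniteMeasure_sumMeasure E hg
  simp_rw [← hE.charFun_diagMeasure, charFun_apply]
  exact hasSum_integral_measure
    ((integrable_const (1 : ℝ)).mono (by fun_prop) (by simp [Complex.norm_exp_ofReal_mul_I]))

/-- States with the same outcome distributions have the same expectations of the characteristic
function. -/
lemma HasCharFun.tsum_inner_eq {V : Type*} [NormedAddCommGroup V] [InnerProductSpace ℝ V]
    [MeasurableSpace V] [BorelSpace V] [SecondCountableTopology V] {E : Observable V H}
    {T : V → H →L[ℂ] H} (hE : E.HasCharFun T) {R S : H →L[ℂ] H}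
    (hR : ∀ x y, ⟪R x, y⟫_ℂ = ⟪x, R y⟫_ℂ) (hRs : Summable fun i => ‖R (stdBasis H i)‖ ^ 2)
    (hS : ∀ x y, ⟪S x, y⟫_ℂ = ⟪x, S y⟫_ℂ) (hSs : Summable fun i => ‖S (stdBasis H i)‖ ^ 2)
    (h : ∀ s, MeasurableSet s → E.prob (R ∘L R) s = E.prob (S ∘L S) s) (p : V) :
    ∑' i, ⟪R (stdBasis H i), T p (R (stdBasis H i))⟫_ℂ =
      ∑' i, ⟪S (stdBasis H i), T p (S (stdBasis H i))⟫_ℂ := by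
  have h1 := isFiniteMeasure_sumMeasure E hRs
  have h2 := isFiniteMeasure_sumMeasure E hSs
  have he : (E.sumMeasure fun i => R (stdBasis H i)) = E.sumMeasure fun i => S (stdBasis H i) := by
    ext s hs
    have := h s hs
    rw [prob_eq_sumMeasure E hR hRs hs, prob_eq_sumMeasure E hS hSs hs] at this
    rw [← measureReal_eq_measureReal_iff]
    exact_mod_cast this
  rw [(hE.hasSum_inner hRs p).tsum_eq, (hE.hasSum_inner hSs p).tsum_eq, he]

end Observable

end Trace

/-! ### States are determined by the expectations of the Weyl operators -/

section WeylTransform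

open FourierTransform Convolution

/-- Cauchy–Schwarz in real L², applied to the moduli. -/
lemma integral_norm_mul_norm_le {α : Type*} [MeasurableSpace α] {μ : Measure α}
    (f g : Lp ℂ 2 μ) : ∫ t, ‖f t‖ * ‖g t‖ ∂μ ≤ ‖f‖ * ‖g‖ := by
  have hf := (Lp.memLp f).norm
  have hg := (Lp.memLp g).norm
  have h := real_inner_le_norm (hg.toLp) (hf.toLp)
  rw [Lp.norm_toLp, Lp.norm_toLp, eLpNorm_norm, eLpNorm_norm, ← Lp.norm_def, ← Lp.norm_def,
    L2.inner_def, mul_comm] at h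
  refine le_of_eq_of_le (integral_congr_ae ?_) h
  filter_upwards [hf.coeFn_toLp, hg.coeFn_toLp] with t h1 h2
  rw [h1, h2]
  simp

lemma integrable_conj_mul {α : Type*} [MeasurableSpace α] {μ : Measure α} (f g : Lp ℂ 2 μ) :
    Integrable (fun t => starRingEnd ℂ (f t) * g t) μ := by
  refine (L2.integrable_inner f g (𝕜 := ℂ)).congr (Filter.Eventually.of_forall fun t => ?_)
  simp [mul_comm]

lemma inner_eq_integral_conj_mul {α : Type*} [MeasurableSpace α] {μ : Measure α}
    (f g : Lp ℂ 2 μ) : ⟪f, g⟫_ℂ = ∫ t, starRingEnd ℂ (f t) * g t ∂μ := by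
  rw [L2.inner_def]
  simp [mul_comm]

variable {N : ℕ}

local notation "V" => EuclideanSpace ℝ (Fin N)

/-- The product of a wave function with its translate. -/
def shiftProd (f : ModeSpace N) (q t : V) : ℂ := starRingEnd ℂ (f t) * f (t - q)

lemma integrable_shiftProd (f : ModeSpace N) (q : V) : Integrable (shiftProd f q) := by
  have hmp := measurePreserving_sub_right (volume : Measure V) q
  refine (integrable_conj_mul f (Lp.compMeasurePreserving (fun t => t - q) hmp f)).congr ?_
  filter_upwards [Lp.coeFn_compMeasurePreserving f hmp] with t ht
  rw [ht]
  rfl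

/-- The Fourier transform of `shiftProd f q` is given by the expectations of Weyl operators. -/
lemma fourier_shiftProd (f : ModeSpace N) (q p : V) :
    𝓕 (shiftProd f q) p = Complex.exp (-(Complex.I * (Real.pi * ⟪q, p⟫_ℝ : ℝ))) *
      ⟪f, weyl (phasePoint q (-(2 * Real.pi) • p)) f⟫_ℂ := by
  rw [Real.fourier_eq', inner_eq_integral_conj_mul, ← integral_const_mul]
  refine integral_congr_ae ?_
  filter_upwards [weyl_coeFn (phasePoint q (-(2 * Real.pi) • p)) f] with t ht
  rw [ht, posPart_phasePoint, weylPhase, posPart_phasePoint, momPart_phasePoint, shiftProd,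
    smul_eq_mul, real_inner_smul_left, real_inner_smul_right, real_inner_comm p t]
  -- The momentum -2πp matches the normalization exp(-2πi⟨p, t⟩) of the Fourier transform; the extra
  -- factor cancels the half-angle phase exp(iπ⟨q, p⟩) of the Weyl operator.
  have : Complex.exp (↑(-2 * Real.pi * ⟪p, t⟫_ℝ) * Complex.I) =
      Complex.exp (-(Complex.I * (Real.pi * ⟪q, p⟫_ℝ : ℝ))) *
        Complex.exp (Complex.I * ↑(-(2 * Real.pi) * ⟪p, t⟫_ℝ - -(2 * Real.pi) * ⟪q, p⟫_ℝ / 2)) := by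
    rw [← Complex.exp_add]
    congr 1
    push_cast
    ring
  rw [this]
  ring

/-- Weyl operators are isometries. The bound is uniform in q and p, so ∑ ‖fᵢ‖² < ∞ alone controls
the sums over i. -/
lemma norm_fourier_shiftProd_le (f : ModeSpace N) (q p : V) :
    ‖𝓕 (shiftProd f q) p‖ ≤ ‖f‖ ^ 2 := by
  rw [fourier_shiftProd, norm_mul, Complex.norm_exp]
  simp only [Complex.neg_re, Complex.mul_re, Complex.I_re, Complex.I_im, Complex.ofReal_re,
    Complex.ofReal_im, zero_mul, mul_zero, sub_zero, neg_zero, Real.exp_zero, one_mul]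
  refine (norm_inner_le_norm _ _).trans ?_
  rw [norm_weyl_apply, sq]

/-- `∑ᵢ ⟨fᵢ, W(q, -2πp) fᵢ⟩`, up to a phase. -/
def weylSum {ι : Type*} (f : ι → ModeSpace N) (q p : V) : ℂ :=
  ∑' i, 𝓕 (shiftProd (f i) q) p

/-- The Fourier transform is moved from one factor to the other, with h written as the transform of
its inverse transform. The i-th term is dominated by ‖fᵢ‖² times the L¹ norm of 𝓕⁻ h, which permits
exchanging sum and integral. -/
lemma hasSum_integral_mul_shiftProd {ι : Type*} [Countable ι] {f : ι → ModeSpace N}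
    (hf : Summable fun i => ‖f i‖ ^ 2) (h : SchwartzMap V ℂ) (q : V) :
    HasSum (fun i => ∫ u, h u * shiftProd (f i) q u)
      (∫ p, weylSum f q p * 𝓕⁻ (h : V → ℂ) p) := by
  set g : SchwartzMap V ℂ := 𝓕⁻ h with hg
  have hgh' : 𝓕⁻ (h : V → ℂ) = g := (SchwartzMap.fourierInv_coe h).symm
  have hgh : 𝓕 (g : V → ℂ) = h := by
    rw [← SchwartzMap.fourier_coe, hg, FourierTransform.fourier_fourierInv_eq]
  have e1 : ∀ i, ∫ u, h u * shiftProd (f i) q u = ∫ p, 𝓕 (shiftProd (f i) q) p * g p := by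
    intro i
    have := VectorFourier.integral_fourierIntegral_smul_eq_flip (L := innerₗ V)
      Real.continuous_fourierChar continuous_inner (integrable_shiftProd (f i) q)
      (g.integrable (μ := volume))
    rw [flip_innerₗ] at this
    rw [← hgh]
    refine Eq.trans ?_ this.symm
    refine integral_congr_ae (Filter.Eventually.of_forall fun u => ?_)
    exact mul_comm _ _
  simp_rw [e1]
  have hcont : ∀ i, Continuous (𝓕 (shiftProd (f i) q)) := fun i =>
    VectorFourier.fourierIntegral_continuous Real.continuous_fourierChar continuous_inner
      (integrable_shiftProd (f i) q)
  have hint : ∀ i, Integrable fun p => 𝓕 (shiftProd (f i) q) p * g p := fun i =>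
    g.integrable.bdd_mul (hcont i).aestronglyMeasurable
      (Filter.Eventually.of_forall fun p => norm_fourier_shiftProd_le (f i) q p)
  have := hasSum_integral_of_summable_integral_norm hint ?_
  · simpa only [weylSum, tsum_mul_right, hgh'] using this
  · refine Summable.of_nonneg_of_le (fun i => by positivity) (fun i => ?_)
      (hf.mul_right (∫ p, ‖g p‖))
    rw [← integral_const_mul]
    refine integral_mono (hint i).norm (g.integrable.norm.const_mul _) fun p => ?_
    simp only [norm_mul]
    exact mul_le_mul_of_nonneg_right (norm_fourier_shiftProd_le (f i) q p) (norm_nonneg _)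

lemma integral_norm_mul_le {φ : V → ℂ} (hφ : MemLp φ 2 volume) (f : ModeSpace N) :
    ∫ t, ‖φ t‖ * ‖f t‖ ≤ ‖hφ.toLp‖ * ‖f‖ := by
  refine le_of_eq_of_le (integral_congr_ae ?_) (integral_norm_mul_norm_le hφ.toLp f)
  filter_upwards [hφ.coeFn_toLp] with t ht
  rw [ht]

/-- The overlap integrals of `f` with test functions as a correlation integral. -/
lemma integral_overlap {a b : V → ℂ} (ha : MemLp a 2 volume) (hb : MemLp b 2 volume)
    (f : ModeSpace N) :
    Integrable (fun q => ∫ u, a (u - q) * b u * shiftProd f q u) ∧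
    ∫ q, ∫ u, a (u - q) * b u * shiftProd f q u =
      (∫ t, a t * f t) * ∫ t, b t * starRingEnd ℂ (f t) ∧
    ∫ q, ‖∫ u, a (u - q) * b u * shiftProd f q u‖ ≤ ‖ha.toLp‖ * ‖hb.toLp‖ * ‖f‖ ^ 2 := by
  -- After this reflection the inner integral is the convolution of G and F at q, so its integral
  -- over q factorizes and its L¹ norm is at most the product of the L¹ norms of G and F.
  set F : V → ℂ := fun t => a (-t) * f (-t) with hF
  set G : V → ℂ := fun t => b t * starRingEnd ℂ (f t) with hG
  have hF0 : Integrable (fun t => a t * f t) := ha.integrable_mul (Lp.memLp f)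
  have hFi : Integrable F := hF0.comp_neg
  have hGi : Integrable G := hb.integrable_mul (Lp.memLp f).star
  have e : (fun q => ∫ u, a (u - q) * b u * shiftProd f q u) =
      G ⋆[ContinuousLinearMap.mul ℂ ℂ, volume] F := by
    funext q
    rw [convolution_def]
    refine integral_congr_ae (Filter.Eventually.of_forall fun u => ?_)
    simp only [hF, hG, shiftProd, neg_sub, ContinuousLinearMap.mul_apply']
    ring
  have hFint : ∫ t, F t = ∫ t, a t * f t := integral_neg_eq_self (fun t => a t * f t) volume
  have hFn : ∫ t, ‖F t‖ = ∫ t, ‖a t‖ * ‖f t‖ := by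
    simp only [← norm_mul]
    exact integral_neg_eq_self (fun t => ‖a t * f t‖) volume
  have hint : Integrable fun q => ∫ u, a (u - q) * b u * shiftProd f q u :=
    e ▸ hGi.integrable_convolution _ hFi
  refine ⟨hint, ?_, ?_⟩
  · rw [e, integral_convolution _ hGi hFi, ContinuousLinearMap.mul_apply', hFint, mul_comm]
  · have hle : ∀ q, ‖∫ u, a (u - q) * b u * shiftProd f q u‖ ≤
        ((fun t => ‖G t‖) ⋆[ContinuousLinearMap.mul ℝ ℝ, volume] fun t => ‖F t‖) q := by
      intro q
      rw [congrFun e q, convolution_def, convolution_def]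
      refine (norm_integral_le_integral_norm _).trans_eq ?_
      simp
    refine (integral_mono hint.norm
      (hGi.norm.integrable_convolution _ hFi.norm) hle).trans ?_
    rw [integral_convolution _ hGi.norm hFi.norm, ContinuousLinearMap.mul_apply', hFn]
    have h1 : ∫ t, ‖G t‖ ≤ ‖hb.toLp‖ * ‖f‖ := by
      simpa [hG] using integral_norm_mul_le hb f
    calc (∫ t, ‖G t‖) * ∫ t, ‖a t‖ * ‖f t‖ ≤ (‖hb.toLp‖ * ‖f‖) * (‖ha.toLp‖ * ‖f‖) :=
          mul_le_mul h1 (integral_norm_mul_le ha f) (by positivity) (by positivity)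
      _ = _ := by ring

/-- The matrix elements of `∑ᵢ |fᵢ⟩⟨fᵢ|` between test functions, in terms of the expectations of
the Weyl operators. -/
lemma hasSum_overlap {ι : Type*} [Countable ι] {f : ι → ModeSpace N}
    (hf : Summable fun i => ‖f i‖ ^ 2) {a b : V → ℂ}
    (ha : HasCompactSupport a) (ha' : ContDiff ℝ (⊤ : ℕ∞) a)
    (hb : HasCompactSupport b) (hb' : ContDiff ℝ (⊤ : ℕ∞) b) :
    HasSum (fun i => (∫ t, a t * f i t) * ∫ t, b t * starRingEnd ℂ (f i t))
      (∫ q, ∫ p, weylSum f q p * 𝓕⁻ (fun u => a (u - q) * b u) p) := by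
  have hA : MemLp a 2 volume := ha'.continuous.memLp_of_hasCompactSupport ha
  have hB : MemLp b 2 volume := hb'.continuous.memLp_of_hasCompactSupport hb
  have hin : ∀ q, ∑' i, (∫ u, a (u - q) * b u * shiftProd (f i) q u) =
      ∫ p, weylSum f q p * 𝓕⁻ (fun u => a (u - q) * b u) p := by
    intro q
    have h1 : HasCompactSupport fun u => a (u - q) * b u := hb.mul_left
    have h2 : ContDiff ℝ (⊤ : ℕ∞) fun u => a (u - q) * b u :=
      (ha'.comp (contDiff_id.sub contDiff_const)).mul hb'
    exact (hasSum_integral_mul_shiftProd hf (h1.toSchwartzMap h2) q).tsum_eq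
  have h := hasSum_integral_of_summable_integral_norm (μ := volume)
    (F := fun i q => ∫ u, a (u - q) * b u * shiftProd (f i) q u)
    (fun i => (integral_overlap hA hB (f i)).1)
    (Summable.of_nonneg_of_le (fun i => by positivity)
      (fun i => (integral_overlap hA hB (f i)).2.2) (hf.mul_left _))
  simp only [hin, (integral_overlap hA hB (f _)).2.1] at h
  exact h

/-- The operator `∑ᵢ |fᵢ⟩⟨fᵢ|` is determined by the expectations of the Weyl operators. -/
lemma tsum_inner_mul_inner_eq_of_weyl {ι κ : Type*} [Countable ι] [Countable κ]
    {f : ι → ModeSpace N} {g : κ → ModeSpace N}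
    (hf : Summable fun i => ‖f i‖ ^ 2) (hg : Summable fun i => ‖g i‖ ^ 2)
    (h : ∀ x, ∑' i, ⟪f i, weyl x (f i)⟫_ℂ = ∑' i, ⟪g i, weyl x (g i)⟫_ℂ)
    {φ ψ : ModeSpace N} {a b : V → ℂ} (hφ : φ =ᵐ[volume] a) (hψ : ψ =ᵐ[volume] b)
    (ha : HasCompactSupport a) (ha' : ContDiff ℝ (⊤ : ℕ∞) a)
    (hb : HasCompactSupport b) (hb' : ContDiff ℝ (⊤ : ℕ∞) b) :
    ∑' i, ⟪φ, f i⟫_ℂ * ⟪f i, ψ⟫_ℂ = ∑' i, ⟪φ, g i⟫_ℂ * ⟪g i, ψ⟫_ℂ := by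
  have e1 : ∀ χ, ⟪φ, χ⟫_ℂ = ∫ t, starRingEnd ℂ (a t) * χ t := fun χ => by
    rw [inner_eq_integral_conj_mul]
    refine integral_congr_ae ?_
    filter_upwards [hφ] with t ht
    rw [ht]
  have e2 : ∀ χ, ⟪χ, ψ⟫_ℂ = ∫ t, b t * starRingEnd ℂ (χ t) := fun χ => by
    rw [inner_eq_integral_conj_mul]
    refine integral_congr_ae ?_
    filter_upwards [hψ] with t ht
    rw [ht, mul_comm]
  have hw : weylSum f = weylSum g := by
    funext q p
    simp only [weylSum, fourier_shiftProd, tsum_mul_left, h]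
  have hc : HasCompactSupport fun t => starRingEnd ℂ (a t) := ha.comp_left (map_zero _)
  have hc' : ContDiff ℝ (⊤ : ℕ∞) fun t => starRingEnd ℂ (a t) :=
    Complex.conjCLE.contDiff.comp ha'
  simp only [e1, e2]
  rw [(hasSum_overlap hf hc hc' hb hb').tsum_eq, (hasSum_overlap hg hc hc' hb hb').tsum_eq, hw]

end WeylTransform

/-! ### Informational completeness -/

section Completeness

/-- Distinct basis vectors are √2 apart, so balls of radius 1/2 around them are disjoint, and a
separable space has only countably many such balls. Countability is needed for exchanging sums over
the basis with integrals. -/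
lemma countable_of_hilbertBasis {H ι : Type*} [NormedAddCommGroup H] [InnerProductSpace ℂ H]
    [TopologicalSpace.SeparableSpace H] (b : HilbertBasis ι ℂ H) : Countable ι := by
  refine Pairwise.countable_of_isOpen_disjoint (s := fun i => Metric.ball (b i) (1 / 2))
    (fun i j hij => Metric.ball_disjoint_ball ?_) (fun i => Metric.isOpen_ball)
    fun i => ⟨b i, Metric.mem_ball_self (by norm_num)⟩
  have h : ‖b i - b j‖ ^ 2 = 2 := by
    rw [@norm_sub_sq ℂ, b.orthonormal.1 i, b.orthonormal.1 j, b.orthonormal.2 hij]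
    norm_num
  rw [dist_eq_norm]
  nlinarith [norm_nonneg (b i - b j)]

variable {N : ℕ}

/-- The square of a self-adjoint Hilbert-Schmidt operator `R` is determined by the expectations
`tr(R² W(x))` of the Weyl operators. -/
lemma comp_self_eq_of_weyl {R S : ModeSpace N →L[ℂ] ModeSpace N}
    (hR : ∀ x y, ⟪R x, y⟫_ℂ = ⟪x, R y⟫_ℂ)
    (hRs : Summable fun i => ‖R (stdBasis (ModeSpace N) i)‖ ^ 2)
    (hS : ∀ x y, ⟪S x, y⟫_ℂ = ⟪x, S y⟫_ℂ)
    (hSs : Summable fun i => ‖S (stdBasis (ModeSpace N) i)‖ ^ 2)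
    (h : ∀ x, ∑' i, ⟪R (stdBasis (ModeSpace N) i), weyl x (R (stdBasis (ModeSpace N) i))⟫_ℂ =
      ∑' i, ⟪S (stdBasis (ModeSpace N) i), weyl x (S (stdBasis (ModeSpace N) i))⟫_ℂ) :
    R ∘L R = S ∘L S := by
  have : Fact ((2 : ℝ≥0∞) ≠ ∞) := ⟨by norm_num⟩
  have : Countable (basisIndex (ModeSpace N)) := countable_of_hilbertBasis (stdBasis (ModeSpace N))
  have key : ∀ T : ModeSpace N →L[ℂ] ModeSpace N, (∀ x y, ⟪T x, y⟫_ℂ = ⟪x, T y⟫_ℂ) →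
      ∀ φ ψ, ⟪φ, (T ∘L T) ψ⟫_ℂ = ∑' i, ⟪φ, T (stdBasis (ModeSpace N) i)⟫_ℂ *
        ⟪T (stdBasis (ModeSpace N) i), ψ⟫_ℂ := fun T hT φ ψ => by
    simp only [hT _ ψ, ← hT φ, ContinuousLinearMap.comp_apply]
    exact ((stdBasis (ModeSpace N)).tsum_inner_mul_inner (T φ) (T ψ)).symm
  -- Matrix elements are continuous in each argument, so smooth compactly supported functions
  -- suffice, first for ψ and then for φ.
  have hD := Lp.dense_hasCompactSupport_contDiff (E := EuclideanSpace ℝ (Fin N)) (F := ℂ)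
    (μ := volume) (p := 2) (by norm_num)
  refine ContinuousLinearMap.coeFn_injective <|
    Continuous.ext_on hD (R ∘L R).continuous (S ∘L S).continuous ?_
  rintro ψ ⟨b, hψ, hb, hb'⟩
  refine ext_inner_left ℂ fun φ => ?_
  refine congrFun (Continuous.ext_on hD (f := fun φ => ⟪φ, (R ∘L R) ψ⟫_ℂ)
    (g := fun φ => ⟪φ, (S ∘L S) ψ⟫_ℂ) (by fun_prop) (by fun_prop) ?_) φ
  rintro φ ⟨a, hφ, ha, ha'⟩
  simp only [key R hR, key S hS]
  exact tsum_inner_mul_inner_eq_of_weyl hRs hSs h hφ hψ ha ha' hb hb'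

/-- The scalar prefactor of the characteristic function of a Gaussian observable. -/
def gaussianFactor {ι : Type*} [Fintype ι] (B : Matrix ι ι ℝ) (v : ι → ℝ)
    (p : EuclideanSpace ℝ ι) : ℂ :=
  Complex.exp (-(1 / 4) * ((p.ofLp ⬝ᵥ B.mulVec p.ofLp : ℝ) : ℂ) -
          Complex.I * ((v ⬝ᵥ p.ofLp : ℝ) : ℂ))

lemma gaussianFactor_ne_zero {ι : Type*} [Fintype ι] (B : Matrix ι ι ℝ) (v : ι → ℝ)
    (p : EuclideanSpace ℝ ι) : gaussianFactor B v p ≠ 0 := Complex.exp_ne_zero _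

lemma IsGaussianWith.hasCharFun {ι : Type*} [Fintype ι]
    {E : Observable (EuclideanSpace ℝ ι) (ModeSpace N)} {A : Matrix (Fin 2 × Fin N) ι ℝ}
    {B : Matrix ι ι ℝ} {v : ι → ℝ} (hE : IsGaussianWith E A B v) :
    E.HasCharFun fun p => gaussianFactor B v p • weyl (WithLp.toLp 2 (A.mulVec p.ofLp)) :=
  hE.2

/-- The quadratic form of `B` is nonnegative. -/
lemma IsGaussianWith.dotProduct_mulVec_nonneg {ι : Type*} [Fintype ι]
    {E : Observable (EuclideanSpace ℝ ι) (ModeSpace N)} {A : Matrix (Fin 2 × Fin N) ι ℝ}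
    {B : Matrix ι ι ℝ} {v : ι → ℝ} (hE : IsGaussianWith E A B v) (c : ι → ℝ) :
    0 ≤ c ⬝ᵥ B.mulVec c := by
  -- On a real vector the symplectic term contributes only to the imaginary part, so the real part
  -- isolates `B`.
  have h := (Complex.nonneg_iff.mp (hE.1.dotProduct_mulVec_nonneg fun i => (c i : ℂ))).1
  simpa [dotProduct, Matrix.mulVec, Matrix.sub_apply, sub_mul, Finset.sum_sub_distrib,
    mul_assoc] using h

variable {E : Observable (PhaseSpace N) (ModeSpace N)}
  {A : Matrix (Fin 2 × Fin N) (Fin 2 × Fin N) ℝ}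
  {B : Matrix (Fin 2 × Fin N) (Fin 2 × Fin N) ℝ} {v : Fin 2 × Fin N → ℝ}

/-- Every x has the form `A p`, and the Gaussian factor at p can be cancelled, so the statistics fix
all expectations of Weyl operators. -/
lemma IsGaussianWith.informationallyComplete (hE : IsGaussianWith E A B v) (hA : A.det ≠ 0) :
    E.InformationallyComplete := by
  intro ρ σ hρ hσ h
  obtain ⟨R, hR, rfl, hRs⟩ := hρ.exists_sqrt
  obtain ⟨S, hS, rfl, hSs⟩ := hσ.exists_sqrt
  refine comp_self_eq_of_weyl hR hRs hS hSs fun x => ?_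
  have h1 := hE.hasCharFun.tsum_inner_eq hR hRs hS hSs h (WithLp.toLp 2 (A⁻¹.mulVec x.ofLp))
  have h2 : A.mulVec (A⁻¹.mulVec x.ofLp) = x.ofLp := by
    rw [Matrix.mulVec_mulVec, Matrix.mul_nonsing_inv _ (isUnit_iff_ne_zero.mpr hA),
      Matrix.one_mulVec]
  simp only [h2, smul_apply, inner_smul_right, tsum_mul_left] at h1
  exact mul_left_cancel₀ (gaussianFactor_ne_zero _ _ _) h1

open InnerProductSpace in
/-- Unit vectors define pure states. -/
lemma isState_rankOne {H : Type*} [NormedAddCommGroup H] [InnerProductSpace ℂ H] [CompleteSpace H]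
    {φ : H} (hφ : ‖φ‖ = 1) : IsState (rankOne ℂ φ φ) where
  isPositive := by
    rw [ContinuousLinearMap.isPositive_iff_complex]
    intro x
    have : ⟪rankOne ℂ φ φ x, x⟫_ℂ = ((‖⟪φ, x⟫_ℂ‖ ^ 2 : ℝ) : ℂ) := by
      rw [rankOne_apply, inner_smul_left, Complex.conj_mul']
      norm_cast
    rw [this]
    refine ⟨rfl, ?_⟩
    rw [RCLike.re_eq_complex_re, Complex.ofReal_re]
    positivity
  hasSum_one := by
    have h := (stdBasis H).hasSum_inner_mul_inner φ φ
    rw [inner_self_eq_norm_sq_to_K, hφ] at h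
    simpa [inner_smul_right] using h

open InnerProductSpace in
lemma Observable.prob_rankOne {X H : Type*} [MeasurableSpace X] [NormedAddCommGroup H]
    [InnerProductSpace ℂ H] [CompleteSpace H] (E : Observable X H) (φ : H) (s : Set X) :
    E.prob (rankOne ℂ φ φ) s = ⟪φ, E.effect s φ⟫_ℂ := by
  have hsymm : ∀ x y, ⟪E.effect s x, y⟫_ℂ = ⟪x, E.effect s y⟫_ℂ :=
    (E.effect_isPositive s).isSymmetric
  rw [prob, trace, ← hsymm, ← (stdBasis H).tsum_inner_mul_inner]
  refine tsum_congr fun i => ?_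
  rw [ContinuousLinearMap.comp_apply, rankOne_apply, inner_smul_right, hsymm]

open InnerProductSpace in
-- A left null vector w of `A` becomes, through the symplectic form, a displacement y that `E`
-- cannot detect.
lemma IsGaussianWith.det_ne_zero_of_informationallyComplete (hE : IsGaussianWith E A B v)
    (hIC : E.InformationallyComplete) : A.det ≠ 0 := by
  intro hA
  obtain ⟨w, hw, hwA⟩ := Matrix.exists_vecMul_eq_zero_iff.mpr hA
  set w' : PhaseSpace N := WithLp.toLp 2 w with hw'
  set y : PhaseSpace N := phasePoint (-momPart w') (posPart w') with hy
  have hyA : ∀ p : PhaseSpace N, symp y (WithLp.toLp 2 (A.mulVec p.ofLp)) = 0 := by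
    intro p
    rw [hy, symp_phasePoint_left, EuclideanSpace.inner_eq_star_dotProduct]
    simp only [hw', star_trivial]
    rw [dotProduct_comm, Matrix.dotProduct_mulVec, hwA, zero_dotProduct]
  have hy0 : y ≠ 0 := by
    intro h0
    have h1 : ⟪w', w'⟫_ℝ = 0 := by
      rw [← symp_phasePoint_left, ← hy, h0]
      simp [symp, show posPart (0 : PhaseSpace N) = 0 from rfl,
        show momPart (0 : PhaseSpace N) = 0 from rfl]
    rw [inner_self_eq_zero] at h1
    exact hw (congrArg WithLp.ofLp h1)
  have hdiag : ∀ φ, E.diagMeasure (weyl y φ) = E.diagMeasure φ := fun φ =>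
    Measure.ext_of_charFun <| funext fun p => by
      rw [hE.hasCharFun.charFun_diagMeasure, hE.hasCharFun.charFun_diagMeasure,
        smul_apply, smul_apply, inner_smul_right,
        inner_smul_right]
      have hc := weyl_comm y (WithLp.toLp 2 (A.mulVec p.ofLp)) φ
      rw [hyA, Complex.ofReal_zero, mul_zero, Complex.exp_zero, one_smul] at hc
      rw [← hc, inner_weyl_weyl]
  -- Informational completeness identifies the pure states of χ and W(y)χ for unit χ, so these
  -- vectors are proportional.
  have heig : ∀ φ : ModeSpace N, ∃ c : ℂ, weyl y φ = c • φ := by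
    intro φ
    by_cases hφ : φ = 0
    · exact ⟨0, by simp [hφ]⟩
    set χ : ModeSpace N := ((‖φ‖ : ℂ)⁻¹) • φ with hχ
    have hn : (‖φ‖ : ℂ) ≠ 0 := by simpa using hφ
    have hχ1 : ‖χ‖ = 1 := by
      rw [hχ, norm_smul, norm_inv, Complex.norm_real, norm_norm]
      exact inv_mul_cancel₀ (norm_ne_zero_iff.mpr hφ)
    have hρ := hIC _ _ (isState_rankOne hχ1)
      (isState_rankOne ((norm_weyl_apply y χ).trans hχ1)) fun s hs => by
        rw [E.prob_rankOne, E.prob_rankOne, E.inner_effect_eq _ hs, E.inner_effect_eq _ hs, hdiag]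
    have h1 := DFunLike.congr_fun hρ χ
    rw [rankOne_apply, rankOne_apply, inner_self_eq_norm_sq_to_K, hχ1] at h1
    have h2 : χ = ⟪weyl y χ, χ⟫_ℂ • weyl y χ := by simpa using h1
    have h3 : ⟪weyl y χ, χ⟫_ℂ ≠ 0 := by
      intro h0
      rw [h0, zero_smul] at h2
      rw [h2, norm_zero] at hχ1
      exact zero_ne_one hχ1
    refine ⟨(⟪weyl y χ, χ⟫_ℂ)⁻¹, ?_⟩
    have h4 : weyl y χ = (⟪weyl y χ, χ⟫_ℂ)⁻¹ • χ := (eq_inv_smul_iff₀ h3).mpr h2.symm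
    have h5 : φ = (‖φ‖ : ℂ) • χ := by rw [hχ, smul_inv_smul₀ hn]
    calc weyl y φ = (‖φ‖ : ℂ) • weyl y χ := by rw [← map_smul, ← h5]
      _ = (‖φ‖ : ℂ) • (⟪weyl y χ, χ⟫_ℂ)⁻¹ • χ := by rw [← h4]
      _ = (⟪weyl y χ, χ⟫_ℂ)⁻¹ • φ := by rw [smul_comm, ← h5]
  -- This W(z) anticommutes with W(y), so φ and W(z)φ have the opposite nonzero eigenvalues c and
  -- -c, although their sum is an eigenvector too.
  obtain ⟨z, hz⟩ := exists_symp_eq hy0 Real.pi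
  obtain ⟨φ, hφ⟩ := exists_ne (0 : ModeSpace N)
  have hanti : weyl y (weyl z φ) = -weyl z (weyl y φ) := by
    rw [weyl_comm, hz, mul_comm, Complex.exp_pi_mul_I, neg_one_smul]
  obtain ⟨c, hc⟩ := heig φ
  obtain ⟨d, hd⟩ := heig (φ + weyl z φ)
  rw [hc, map_smul] at hanti
  have hzφ : weyl z φ ≠ 0 := by
    rw [← norm_ne_zero_iff, norm_weyl_apply]
    exact norm_ne_zero_iff.mpr hφ
  have hc0 : c ≠ 0 := by
    rintro rfl
    rw [zero_smul, ← norm_eq_zero, norm_weyl_apply, norm_eq_zero] at hc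
    exact hφ hc
  rw [map_add, hc, hanti] at hd
  have h1 : (c - d) • φ = (c + d) • weyl z φ := by
    rw [← sub_eq_zero] at hd ⊢
    rw [← hd]
    module
  -- Applying W(y) flips the relative sign of the two sides of `h1`, so both vanish; then d = c and
  -- d = -c, contradicting c ≠ 0.
  have h2 := congrArg (weyl y) h1
  rw [map_smul, map_smul, hc, hanti, smul_neg, smul_comm _ c, smul_comm _ c, ← h1, ← smul_neg,
    smul_right_inj hc0] at h2
  have h3 : (c - d) • φ = 0 := by
    have h : (2 : ℂ) • (c - d) • φ = 0 := by
      rw [two_smul]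
      exact eq_neg_iff_add_eq_zero.mp h2
    exact (smul_eq_zero.mp h).resolve_left two_ne_zero
  have h4 : c - d = 0 := (smul_eq_zero.mp h3).resolve_right hφ
  rw [h3] at h1
  have h5 : c + d = 0 := (smul_eq_zero.mp h1.symm).resolve_right hzφ
  exact hc0 (by linear_combination (h4 + h5) / 2)

end Completeness

/-! ### Marginals and generalized quadratures -/

section Marginals

variable {N : ℕ}

/-- Since t P(x) = ⟨t c, x⟩, passing to the marginal restricts the characteristic function to the
line through the Riesz vector c. -/
lemma Observable.HasCharFun.postprocess {V H : Type*} [NormedAddCommGroup V]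
    [InnerProductSpace ℝ V] [FiniteDimensional ℝ V] [MeasurableSpace V] [BorelSpace V]
    [NormedAddCommGroup H] [InnerProductSpace ℂ H] [CompleteSpace H] {E : Observable V H}
    {T : V → H →L[ℂ] H} (hE : E.HasCharFun T) {P : V →ₗ[ℝ] ℝ} {c : V} (hP : ∀ x, P x = ⟪c, x⟫_ℝ) :
    (E.postprocess P).HasCharFun fun t => T (t • c) := by
  have hPm : Measurable P := P.continuous_of_finiteDimensional.measurable
  intro t φ
  rw [hE (t • c) φ, Observable.postprocess, Observable.diagMeasure_map,
    integral_map hPm.aemeasurable (Measurable.aestronglyMeasurable (by fun_prop))]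
  refine integral_congr_ae (Filter.Eventually.of_forall fun x => ?_)
  simp [hP, real_inner_smul_left, mul_comm]

lemma IsQuadratureOf.unique {a : PhaseSpace N} {Q Q' : Observable ℝ (ModeSpace N)}
    (hQ : IsQuadratureOf a Q) (hQ' : IsQuadratureOf a Q') : Q = Q' :=
  hQ.2.unique hQ'.2

/-- A quadrature determines its direction. -/
lemma IsQuadratureOf.eq_of_eq {a b : PhaseSpace N} {Q : Observable ℝ (ModeSpace N)}
    (ha : IsQuadratureOf a Q) (hb : IsQuadratureOf b Q) : a = b := by
  refine eq_of_smul_weyl_eq (one_ne_zero' ℂ) (d := 1) ?_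
  refine congrArg _ (clm_ext_inner fun φ => ?_)
  have h1 := ha.2.charFun_diagMeasure φ 1
  have h2 := hb.2.charFun_diagMeasure φ 1
  rw [one_smul] at h1 h2
  rw [← h1, h2]

/-- The generalized quadratures are parametrized by phase space. -/
def quadratureEquiv (N : ℕ) : PhaseSpace N ≃ generalizedQuadratures N :=
  Equiv.ofBijective
    (fun a => ⟨(exists_isQuadratureOf a).choose, a, (exists_isQuadratureOf a).choose_spec⟩)
    ⟨fun a b h => by
      have h' := congrArg Subtype.val h
      have ha := (exists_isQuadratureOf a).choose_spec
      have hb := (exists_isQuadratureOf b).choose_spec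
      simp only at h'
      rw [← h'] at hb
      exact ha.eq_of_eq hb,
    fun Q => by
      obtain ⟨a, ha⟩ := Q.2
      exact ⟨a, Subtype.ext ((exists_isQuadratureOf a).choose_spec.unique ha)⟩⟩

lemma isQuadratureOf_quadratureEquiv (a : PhaseSpace N) :
    IsQuadratureOf a (quadratureEquiv N a : Observable ℝ (ModeSpace N)) :=
  (exists_isQuadratureOf a).choose_spec

/-- The Riesz representation of linear functionals on phase space. -/
def rieszEquiv (N : ℕ) : (PhaseSpace N →ₗ[ℝ] ℝ) ≃ PhaseSpace N :=
  (LinearMap.toContinuousLinearMap.toEquiv).trans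
    (InnerProductSpace.toDual ℝ (PhaseSpace N)).symm.toEquiv

lemma inner_rieszEquiv (P : PhaseSpace N →ₗ[ℝ] ℝ) (x : PhaseSpace N) :
    P x = ⟪rieszEquiv N P, x⟫_ℝ :=
  (InnerProductSpace.toDual_symm_apply (x := x) (y := LinearMap.toContinuousLinearMap P)).symm

variable {E : Observable (PhaseSpace N) (ModeSpace N)}
  {A : Matrix (Fin 2 × Fin N) (Fin 2 × Fin N) ℝ}
  {B : Matrix (Fin 2 × Fin N) (Fin 2 × Fin N) ℝ} {v : Fin 2 × Fin N → ℝ}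

lemma toLp_mulVec_smul (A : Matrix (Fin 2 × Fin N) (Fin 2 × Fin N) ℝ) (t : ℝ) (c : PhaseSpace N) :
    (WithLp.toLp 2 (A.mulVec (t • c).ofLp) : PhaseSpace N) =
      t • WithLp.toLp 2 (A.mulVec c.ofLp) := by
  rw [WithLp.ofLp_smul, Matrix.mulVec_smul, WithLp.toLp_smul]

/-- The marginal of a Gaussian observable along `c` is a Gaussian smearing of the quadrature along
`A c`. -/
lemma IsGaussianWith.isGaussianSmearing (hE : IsGaussianWith E A B v) {P : PhaseSpace N →ₗ[ℝ] ℝ}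
    {c : PhaseSpace N} (hP : ∀ x, P x = ⟪c, x⟫_ℝ) {Q : Observable ℝ (ModeSpace N)}
    (hQ : IsQuadratureOf (WithLp.toLp 2 (A.mulVec c.ofLp)) Q) :
    (E.postprocess P).IsGaussianSmearing Q := by
  have hB : 0 ≤ c.ofLp ⬝ᵥ B.mulVec c.ofLp / 2 := by
    have := hE.dotProduct_mulVec_nonneg c.ofLp
    positivity
  -- Mean and variance are read off from exp(i t m - t² s / 2) = exp(-t² cᵀBc / 4 - i t vᵀc).
  refine ⟨ProbabilityTheory.gaussianReal (-(v ⬝ᵥ c.ofLp))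
      (c.ofLp ⬝ᵥ B.mulVec c.ofLp / 2).toNNReal, inferInstance,
    Observable.isConvolution_iff.mpr fun φ => Measure.ext_of_charFun (funext fun t => ?_)⟩
  rw [(hE.hasCharFun.postprocess hP).charFun_diagMeasure, charFun_conv,
    ProbabilityTheory.charFun_gaussianReal, hQ.2.charFun_diagMeasure, smul_apply,
    inner_smul_right, toLp_mulVec_smul]
  congr 1
  rw [gaussianFactor, WithLp.ofLp_smul, Matrix.mulVec_smul, smul_dotProduct, dotProduct_smul,
    dotProduct_smul]
  congr 1
  simp only [smul_eq_mul, Real.coe_toNNReal _ hB]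
  push_cast
  ring

/-- If the marginal along `c` is a smearing of a quadrature, then it is the quadrature along
`A c`. -/
lemma IsGaussianWith.isQuadratureOf_of_isGaussianSmearing (hE : IsGaussianWith E A B v)
    {P : PhaseSpace N →ₗ[ℝ] ℝ} {c : PhaseSpace N} (hP : ∀ x, P x = ⟪c, x⟫_ℝ)
    {Q : Observable ℝ (ModeSpace N)} (hQ : Q ∈ generalizedQuadratures N)
    (h : (E.postprocess P).IsGaussianSmearing Q) :
    IsQuadratureOf (WithLp.toLp 2 (A.mulVec c.ofLp)) Q := by
  obtain ⟨a, ha⟩ := hQ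
  obtain ⟨μ, hμ, hconv⟩ := h
  have hd := Observable.isConvolution_iff.mp hconv
  -- Comparing characteristic functions at t = 1 makes W(`A c`) and W(a) proportional, with a
  -- nonzero factor on the left, which forces a = `A c`.
  have hw : gaussianFactor B v c • weyl (WithLp.toLp 2 (A.mulVec c.ofLp)) =
      charFun μ 1 • weyl a := by
    refine clm_ext_inner fun φ => ?_
    have h1 := (hE.hasCharFun.postprocess hP).charFun_diagMeasure φ 1
    rw [hd, charFun_conv, ha.2.charFun_diagMeasure, one_smul, one_smul] at h1
    rw [← h1, smul_apply, inner_smul_right]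
  rwa [eq_of_smul_weyl_eq (gaussianFactor_ne_zero _ _ _) hw]

/-- The bijection is the composite P ↦ c ↦ `A c` ↦ Q with direction `A c`. -/
lemma IsGaussianWith.exists_equiv (hE : IsGaussianWith E A B v) (hA : A.det ≠ 0) :
    ∃ Φ : (PhaseSpace N →ₗ[ℝ] ℝ) ≃ generalizedQuadratures N,
      ∀ P : PhaseSpace N →ₗ[ℝ] ℝ,
        (E.postprocess P).IsGaussianSmearing (Φ P : Observable ℝ (ModeSpace N)) := by
  have hu : IsUnit A.det := isUnit_iff_ne_zero.mpr hA
  let e : PhaseSpace N ≃ PhaseSpace N :=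
    { toFun := fun c => WithLp.toLp 2 (A.mulVec c.ofLp)
      invFun := fun c => WithLp.toLp 2 (A⁻¹.mulVec c.ofLp)
      left_inv := fun c => by
        simp [Matrix.mulVec_mulVec, Matrix.nonsing_inv_mul _ hu]
      right_inv := fun c => by
        simp [Matrix.mulVec_mulVec, Matrix.mul_nonsing_inv _ hu] }
  exact ⟨((rieszEquiv N).trans e).trans (quadratureEquiv N), fun P =>
    hE.isGaussianSmearing (inner_rieszEquiv P) (isQuadratureOf_quadratureEquiv _)⟩

/-- The quadrature assigned to ⟨c, ·⟩ must have direction `A c`. A nonzero kernel vector would thus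
share the quadrature of direction 0 with the zero functional, against injectivity. -/
lemma IsGaussianWith.det_ne_zero_of_equiv (hE : IsGaussianWith E A B v)
    (Φ : (PhaseSpace N →ₗ[ℝ] ℝ) ≃ generalizedQuadratures N)
    (hΦ : ∀ P : PhaseSpace N →ₗ[ℝ] ℝ,
      (E.postprocess P).IsGaussianSmearing (Φ P : Observable ℝ (ModeSpace N))) : A.det ≠ 0 := by
  intro hA
  obtain ⟨c, hc, hAc⟩ := Matrix.exists_mulVec_eq_zero_iff.mpr hA
  have key : ∀ d : PhaseSpace N, A.mulVec d.ofLp = 0 →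
      IsQuadratureOf 0 (Φ ((rieszEquiv N).symm d) : Observable ℝ (ModeSpace N)) := by
    intro d hd
    have h := hE.isQuadratureOf_of_isGaussianSmearing
      (inner_rieszEquiv ((rieszEquiv N).symm d)) (Φ _).2 (hΦ ((rieszEquiv N).symm d))
    rwa [Equiv.apply_symm_apply, hd, WithLp.toLp_zero] at h
  have h := Subtype.ext ((key (WithLp.toLp 2 c) hAc).unique (key 0 (by simp)))
  have h0 := (rieszEquiv N).symm.injective (Φ.injective h)
  exact hc (congrArg WithLp.ofLp h0)

end Marginals

end GaussianObs

end

/-- A Gaussian phase space observable `E` is informationally complete if and only if there is a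
bijection between the linear maps `P : ℝ²ᴺ → ℝ` and the generalized quadratures `Q_a` such that
each marginal `E_P` is a Gaussian smearing of the corresponding `Q_a`. -/
theorem mainTheorem10 (N : ℕ)
    (E : GaussianObs.Observable (GaussianObs.PhaseSpace N) (GaussianObs.ModeSpace N))
    (hE : GaussianObs.IsGaussianObservable E) :
    E.InformationallyComplete ↔
      ∃ Φ : (GaussianObs.PhaseSpace N →ₗ[ℝ] ℝ) ≃ GaussianObs.generalizedQuadratures N,
        ∀ P : GaussianObs.PhaseSpace N →ₗ[ℝ] ℝ,
          (E.postprocess P).IsGaussianSmearing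
            (Φ P : GaussianObs.Observable ℝ (GaussianObs.ModeSpace N)) := by
  obtain ⟨A, B, v, h⟩ := hE
  exact ⟨fun hIC => h.exists_equiv (h.det_ne_zero_of_informationallyComplete hIC),
    fun ⟨Φ, hΦ⟩ => h.informationallyComplete (h.det_ne_zero_of_equiv Φ hΦ)⟩
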